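/- **Theorem (optimal complexity of sub-sampled adaptive cubic regularization for finite sums).** Let $\eta\in(0,1)$, $\gamma>1$, $\nu\in(0,1]$, $\zeta\in(0,1/2)$, $0<\sigma_{\min}\le\sigma_0$, $L>0$, $\bar K>0$ and $\Delta\ge 0$. There is a constant $C\ge 1$, depending only on $\eta,\gamma,\nu,\zeta,\sigma_{\min},\sigma_0,L,\bar K,\Delta$, such that the following holds. *Problem.* Let $n,d\ge1$ and $F=\frac1n\sum_{i=1}^n f_i$ with $f_i:\mathbb R^d\to\mathbb R$ twice differentiable, $\sup_x\|\nabla^2 f_i(x)\|\le K_i$, and $F(x_0)-\inf F\le\Delta$. Put $K_{\max}=\max_iK_i$ and $\widehat K=\frac1n\sum_iK_i$. Consider either (a) general $f_i$, with indices drawn uniformly ($p_i=1/n$), with or without replacement; or (b) $f_i(x)=\varphi_i(a_i^Tx)$ with $a_i\in\mathbb R^d$ and $\varphi_i:\mathbb R\to\mathbb R$ twice differentiable, with indices drawn with replacement from the distribution $p_i(x)=|\varphi_i''(a_i^Tx)|\,\|a_i\|^2/\sum_j|\varphi_j''(a_j^Tx)|\,\|a_j\|^2$ at the current point $x$ (arbitrary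 samples if the denominator is $0$). Let $0<K_H\le\bar K$, with $K_{\max}\le K_H$ in case (a) and $\widehat K\le K_H$ in case (b). *Tolerances and sample size.* Let $\epsilon_g,\epsilon_H,\delta\in(0,1)$ and $\epsilon=\min\{\epsilon_0,\zeta\epsilon_g\}$, where $$0<\epsilon_0\le\min\Big\{\min\{\tfrac1{12},\tfrac{1-\eta}6\}\big(\sqrt{K_H^2+8L\epsilon_g}-K_H\big),\ \min\{\tfrac16,\tfrac{1-\eta}3\}\,\nu\,\epsilon_H\Big\}.$$ Let $\delta_0=\frac{\delta}{C}\min\{\epsilon_g^{3/2},\epsilon_H^3\}$, and let the sample size $|\mathcal S|$ satisfy $|\mathcal S|\ge\frac{16K_{\max}^2}{\epsilon^2}\log\frac{2d}{\delta_0}$ in case (a) and $|\mathcal S|\ge\frac{4\widehat K^2}{\epsilon^2}\log\frac{2d}{\delta_0}$ in case (b). *Algorithm.* At iteration $t=0,1,\dots$, draw a sample $\mathcal S_t$ of size $|\mathcal S|$ as in (a) or (b), conditionally on the past, and set $H_t=\frac1{n|\mathcal S|}\sum_{j\in\mathcal S_t}\frac1{p_j}\nabla^2f_j(x_t)$. If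 $\|\nabla F(x_t)\|\le\epsilon_g$ and $\lambda_{\min}(H_t)\ge-\epsilon_H$, return $x_t$. Otherwise, with the model $m_t(s)=\langle\nabla F(x_t),s\rangle+\frac12\langle s,H_ts\rangle+\frac{\sigma_t}3\|s\|^3$, compute a step $s_t$ and set $\rho_t=\frac{F(x_t)-F(x_t+s_t)}{-m_t(s_t)}$. If $\rho_t\ge\eta$, then $x_{t+1}=x_t+s_t$ and $\sigma_{t+1}=\max\{\sigma_t/\gamma,\sigma_{\min}\}$; otherwise $x_{t+1}=x_t$ and $\sigma_{t+1}=\gamma\sigma_t$. *Sub-problem.* It is assumed that, at each such iteration, $s_t$ minimizes $m_t$ over some linear subspace of $\mathbb R^d$ that contains $s_t^C$ and, if $\lambda_{\min}(H_t)<0$, $s_t^E$, and that the following hold: * $s_t^C=-\alpha\nabla F(x_t)$ for some $\alpha\ge0$, and $$-m_t(s_t)\ge-m_t(s_t^C)\ge\max\Big\{\tfrac1{12}\|s_t^C\|^2\big(\sqrt{K_H^2+4\sigma_t\|\nabla F(x_t)\|}-K_H\big),\ \tfrac{\|\nabla F(x_t)\|}{2\sqrt3}\min\big\{\tfrac{\|\nabla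 F(x_t)\|}{K_H},\sqrt{\tfrac{\|\nabla F(x_t)\|}{\sigma_t}}\big\}\Big\};$$ * if $\lambda_{\min}(H_t)<0$, then $\langle s_t^E,H_ts_t^E\rangle\le\nu\lambda_{\min}(H_t)\|s_t^E\|^2<0$ and $$-m_t(s_t)\ge-m_t(s_t^E)\ge\tfrac{\nu|\lambda_{\min}(H_t)|}6\max\Big\{\|s_t^E\|^2,\tfrac{\nu^2|\lambda_{\min}(H_t)|^2}{\sigma_t^2}\Big\};$$ * (gradient stopping) $\|\nabla m_t(s_t)\|\le\zeta\max\{\|s_t\|^2,\theta_t\|\nabla F(x_t)\|\}$ with $\theta_t=\min\{1,\|s_t\|\}$. *Regularity.* It is also assumed that, at each such iteration, $\|\nabla^2F(y)-\nabla^2F(x_t)\|\le L\|y-x_t\|$ for all $y\in[x_t,x_t+s_t]$. *Conclusion.* With probability at least $1-\delta$, the algorithm returns a point $x_T$ at some iteration $T\le C\max\{\epsilon_g^{-3/2},\epsilon_H^{-3}\}$, and $\|\nabla F(x_T)\|\le\epsilon_g$ and $\lambda_{\min}(\nabla^2F(x_T))\ge-(\epsilon+\epsilon_H)$. -/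

import Mathlib

open MeasureTheory ProbabilityTheory

noncomputable section

namespace SubsampledARC

/-- The space `ℝ^d` with its Euclidean norm. -/
abbrev Vec (d : ℕ) : Type := EuclideanSpace ℝ (Fin d)

/-- Symmetric `d × d` matrices are regarded as operators on `ℝ^d`; the norm of this type is the
spectral norm. -/
abbrev Op (d : ℕ) : Type := Vec d →L[ℝ] Vec d

/-- The Hessian of `F` at `x`. -/
def hessian {d : ℕ} (F : Vec d → ℝ) (x : Vec d) : Op d := fderiv ℝ (gradient F) x

/-- `F` is twice differentiable on `ℝ^d`. -/
def TwiceDifferentiable {d : ℕ} (F : Vec d → ℝ) : Prop :=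
  Differentiable ℝ F ∧ Differentiable ℝ (gradient F)

/-- The smallest eigenvalue of a symmetric operator, as the minimum of its Rayleigh quotient. -/
def lamMin {d : ℕ} (H : Op d) : ℝ := ⨅ v : {v : Vec d // v ≠ 0}, H.rayleighQuotient (v : Vec d)

/-- For a symmetric operator (and `d ≥ 1`), `lamMin` is indeed the smallest eigenvalue. -/
theorem lamMin_isLeast {d : ℕ} (hd : 0 < d) (H : Op d) (hH : IsSelfAdjoint H) :
    IsLeast {l : ℝ | Module.End.HasEigenvalue (H : Vec d →ₗ[ℝ] Vec d) l} (lamMin H) := by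
  have : Nonempty (Fin d) := ⟨⟨0, hd⟩⟩
  have : Nontrivial (Vec d) := by
    refine ⟨⟨EuclideanSpace.single ⟨0, hd⟩ (1 : ℝ), 0, fun h => ?_⟩⟩
    have := congrArg norm h
    simp at this
  have hS : (H : Vec d →ₗ[ℝ] Vec d).IsSymmetric :=
    ContinuousLinearMap.isSelfAdjoint_iff_isSymmetric.mp hH
  refine ⟨hS.hasEigenvalue_iInf_of_finiteDimensional, fun l hl => ?_⟩
  obtain ⟨v, hv⟩ := hl.exists_hasEigenvector
  have hbdd : BddBelow (Set.range fun v : {v : Vec d // v ≠ 0} => H.rayleighQuotient (v : Vec d)) :=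
    ⟨-‖H‖, by
      rintro _ ⟨w, rfl⟩
      exact (abs_le.mp (H.rayleighQuotient_le_norm (w : Vec d))).1⟩
  refine (ciInf_le hbdd ⟨v, hv.2⟩).trans (le_of_eq ?_)
  have hHv : H v = l • v := hv.apply_eq_smul
  have hn : ‖v‖ ^ 2 ≠ 0 := pow_ne_zero 2 (norm_ne_zero_iff.mpr hv.2)
  simp only [ContinuousLinearMap.rayleighQuotient, ContinuousLinearMap.reApplyInnerSelf_apply, hHv,
    inner_smul_left, real_inner_self_eq_norm_sq]
  exact mul_div_cancel_right₀ l hn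

/-- The finite-sum objective `F = (1/n) ∑ f_i`. -/
def finiteSum {d n : ℕ} (f : Fin n → Vec d → ℝ) (x : Vec d) : ℝ :=
  (1 / (n : ℝ)) * ∑ i, f i x

/-- The sub-sampled Hessian `(1 / (n |S|)) ∑_{j ∈ S} (1 / p_j) ∇² f_j(x)`; the sample `S` is the
list of the `N` indices that were drawn, repetitions included. -/
def subsampledHessian {d n N : ℕ} (f : Fin n → Vec d → ℝ) (p : Fin n → ℝ) (S : Fin N → Fin n)
    (x : Vec d) : Op d :=
  (1 / ((n : ℝ) * (N : ℝ))) • ∑ k, (1 / p (S k)) • hessian (f (S k)) x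

/-! ### Adaptive cubic regularization -/

/-- The cubic model `m(s) = ⟨g, s⟩ + ⟨s, H s⟩ / 2 + (σ / 3) ‖s‖³`. -/
def cubicModel {d : ℕ} (g : Vec d) (H : Op d) (σ : ℝ) (s : Vec d) : ℝ :=
  inner ℝ g s + (1 / 2) * inner ℝ s (H s) + (σ / 3) * ‖s‖ ^ 3

/-- The sufficient descent condition for a step `s`, with a Cauchy point `sC` on the ray of the
negative gradient and, when `H` has a negative eigenvalue, a point `sE` along a direction of
approximately most negative curvature. -/
structure SufficientDescent {d : ℕ} (KH ν : ℝ) (g : Vec d) (H : Op d) (σ : ℝ)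
    (s sC sE : Vec d) : Prop where
  cauchy_dir : ∃ α : ℝ, 0 ≤ α ∧ sC = -(α • g)
  cauchy_le : -cubicModel g H σ sC ≤ -cubicModel g H σ s
  cauchy_descent :
    max ((1 / 12) * ‖sC‖ ^ 2 * (√(KH ^ 2 + 4 * σ * ‖g‖) - KH))
        (‖g‖ / (2 * √3) * min (‖g‖ / KH) (√(‖g‖ / σ)))
      ≤ -cubicModel g H σ sC
  eigen_dir : lamMin H < 0 →
    inner ℝ sE (H sE) ≤ ν * lamMin H * ‖sE‖ ^ 2 ∧ ν * lamMin H * ‖sE‖ ^ 2 < 0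
  eigen_le : lamMin H < 0 → -cubicModel g H σ sE ≤ -cubicModel g H σ s
  eigen_descent : lamMin H < 0 →
    ν * |lamMin H| / 6 * max (‖sE‖ ^ 2) (ν ^ 2 * |lamMin H| ^ 2 / σ ^ 2)
      ≤ -cubicModel g H σ sE

/-- The gradient stopping condition
`‖∇m(s)‖ ≤ ζ max {‖s‖², θ ‖g‖}` with `θ = min {1, ‖s‖}`. -/
def GradientStopping {d : ℕ} (ζ : ℝ) (g : Vec d) (H : Op d) (σ : ℝ) (s : Vec d) : Prop :=
  ‖gradient (cubicModel g H σ) s‖ ≤ ζ * max (‖s‖ ^ 2) (min 1 ‖s‖ * ‖g‖)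

/-- `s` is an admissible approximate solution of the cubic sub-problem: it minimizes the model over
some linear subspace that contains the Cauchy and eigen points, and it satisfies the sufficient
descent condition and the gradient stopping condition. -/
def ApproxSolves {d : ℕ} (KH ν ζ : ℝ) (g : Vec d) (H : Op d) (σ : ℝ) (s : Vec d) : Prop :=
  ∃ (sC sE : Vec d) (P : Submodule ℝ (Vec d)),
    SufficientDescent KH ν g H σ s sC sE ∧
    GradientStopping ζ g H σ s ∧
    sC ∈ P ∧ (lamMin H < 0 → sE ∈ P) ∧ s ∈ P ∧
    ∀ v ∈ P, cubicModel g H σ s ≤ cubicModel g H σ v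

/-- The termination test of the algorithm. -/
def Stops {d : ℕ} (εg εH : ℝ) (F : Vec d → ℝ) (H : Op d) (x : Vec d) : Prop :=
  ‖gradient F x‖ ≤ εg ∧ -εH ≤ lamMin H

/-- The algorithm did not return at any of the iterations `0, …, t`. -/
def Running {d : ℕ} (εg εH : ℝ) (F : Vec d → ℝ) (H : ℕ → Op d) (x : ℕ → Vec d) (t : ℕ) : Prop :=
  ∀ u ≤ t, ¬ Stops εg εH F (H u) (x u)

/-- The ratio `ρ = (F(x) - F(x + s)) / (-m(s))` of actual to predicted decrease. -/
def ratio {d : ℕ} (F : Vec d → ℝ) (H : Op d) (σ : ℝ) (x s : Vec d) : ℝ :=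
  (F x - F (x + s)) / (-cubicModel (gradient F x) H σ s)

/-- A run of adaptive cubic regularization with the approximate Hessians `H t`, iterates `x t`,
steps `s t` and regularization parameters `σ t`. Nothing is required after the algorithm has
returned. The parameter `σ t` is not decreased below the floor `σmin`. -/
structure IsARCRun {d : ℕ} (εg εH η γ σmin KH ν ζ : ℝ) (F : Vec d → ℝ) (x₀ : Vec d) (σ₀ : ℝ)
    (H : ℕ → Op d) (x s : ℕ → Vec d) (σ : ℕ → ℝ) : Prop where
  init_x : x 0 = x₀
  init_σ : σ 0 = σ₀
  subproblem : ∀ t, Running εg εH F H x t →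
    ApproxSolves KH ν ζ (gradient F (x t)) (H t) (σ t) (s t)
  accept : ∀ t, Running εg εH F H x t → η ≤ ratio F (H t) (σ t) (x t) (s t) →
    x (t + 1) = x t + s t ∧ σ (t + 1) = max (σ t / γ) σmin
  reject : ∀ t, Running εg εH F H x t → ratio F (H t) (σ t) (x t) (s t) < η →
    x (t + 1) = x t ∧ σ (t + 1) = γ * σ t

/-- Lipschitz continuity of the Hessian of `F` along the path of the run: at each iteration,
`‖∇²F(y) - ∇²F(x_t)‖ ≤ L ‖y - x_t‖` for `y` in the segment `[x_t, x_t + s_t]`. -/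
def LipschitzOnPath {d : ℕ} (εg εH L : ℝ) (F : Vec d → ℝ) (H : ℕ → Op d) (x s : ℕ → Vec d) :
    Prop :=
  ∀ t, Running εg εH F H x t → ∀ y ∈ segment ℝ (x t) (x t + s t),
    ‖hessian F y - hessian F (x t)‖ ≤ L * ‖y - x t‖

/-- The upper bound on the tolerance `ε₀`. -/
def toleranceBound (L KH η ν εg εH : ℝ) : ℝ :=
  min (min (1 / 12) ((1 - η) / 6) * (√(KH ^ 2 + 8 * L * εg) - KH))
    (min (1 / 6) ((1 - η) / 3) * ν * εH)

/-! ### Random sampling -/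

section Sampling

variable {Ω : Type*} {mΩ : MeasurableSpace Ω}

/-- At every iteration `N` indices are drawn uniformly with replacement, independently of the
past. -/
def UniformWithReplacement {n N : ℕ} (μ : Measure Ω) (ℱ : Filtration ℕ mΩ)
    (S : ℕ → Ω → Fin N → Fin n) : Prop :=
  ∀ (t : ℕ) (j : Fin N → Fin n),
    μ[(S t ⁻¹' {j}).indicator (fun _ => (1 : ℝ)) | ℱ t] =ᵐ[μ] fun _ => (1 / (n : ℝ)) ^ N

open Classical in
/-- At every iteration `N` distinct indices are drawn uniformly without replacement, independently
of the past. -/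
def UniformWithoutReplacement {n N : ℕ} (μ : Measure Ω) (ℱ : Filtration ℕ mΩ)
    (S : ℕ → Ω → Fin N → Fin n) : Prop :=
  ∀ (t : ℕ) (j : Fin N → Fin n),
    μ[(S t ⁻¹' {j}).indicator (fun _ => (1 : ℝ)) | ℱ t] =ᵐ[μ]
      fun _ => if Function.Injective j then 1 / (n.descFactorial N : ℝ) else 0

/-- The functions `x ↦ φ_i(a_iᵀ x)`. -/
def ridge {d n : ℕ} (φ : Fin n → ℝ → ℝ) (a : Fin n → Vec d) (i : Fin n) (x : Vec d) : ℝ :=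
  φ i (inner ℝ (a i) x)

/-- The weights `|φ_i''(a_iᵀ x)| ‖a_i‖²`. -/
def ridgeWeight {d n : ℕ} (φ : Fin n → ℝ → ℝ) (a : Fin n → Vec d) (x : Vec d) (i : Fin n) : ℝ :=
  |deriv (deriv (φ i)) (inner ℝ (a i) x)| * ‖a i‖ ^ 2

/-- The non-uniform sampling distribution, i.e. the normalized weights. -/
def ridgeProb {d n : ℕ} (φ : Fin n → ℝ → ℝ) (a : Fin n → Vec d) (x : Vec d) (i : Fin n) : ℝ :=
  ridgeWeight φ a x i / ∑ j, ridgeWeight φ a x j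

/-- At every iteration `N` indices are drawn independently (with replacement) from the non-uniform
distribution at the current iterate. When all weights vanish there, so that this distribution is
not defined (all the `∇² f_i` are then zero), the sample may be arbitrary. -/
def NonuniformSampling {d n N : ℕ} (μ : Measure Ω) (ℱ : Filtration ℕ mΩ)
    (φ : Fin n → ℝ → ℝ) (a : Fin n → Vec d) (x : ℕ → Ω → Vec d)
    (S : ℕ → Ω → Fin N → Fin n) : Prop :=
  ∀ (t : ℕ) (j : Fin N → Fin n), ∀ᵐ ω ∂μ, (∑ i, ridgeWeight φ a (x t ω) i) ≠ 0 →
    (μ[(S t ⁻¹' {j}).indicator (fun _ => (1 : ℝ)) | ℱ t]) ω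
      = ∏ k, ridgeProb φ a (x t ω) (j k)

/-- The random algorithm: `ℱ t` is the information available before the sample of iteration `t` is
drawn, and almost every path is a run of adaptive cubic regularization along which the Hessian of
`F` is Lipschitz continuous. -/
structure IsRandomARC {d n N : ℕ} (μ : Measure Ω) (ℱ : Filtration ℕ mΩ)
    (εg εH η γ σmin KH ν ζ L : ℝ) (F : Vec d → ℝ) (x₀ : Vec d) (σ₀ : ℝ)
    (S : ℕ → Ω → Fin N → Fin n) (H : ℕ → Ω → Op d) (x s : ℕ → Ω → Vec d) (σ : ℕ → Ω → ℝ) :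
    Prop where
  measurable_sample : ∀ t, Measurable (S t)
  adapted : ∀ t, Measurable[ℱ t] (x t)
  isRun : ∀ᵐ ω ∂μ, IsARCRun εg εH η γ σmin KH ν ζ F x₀ σ₀
    (fun t => H t ω) (fun t => x t ω) (fun t => s t ω) (fun t => σ t ω)
  lipschitz : ∀ᵐ ω ∂μ, LipschitzOnPath εg εH L F
    (fun t => H t ω) (fun t => x t ω) (fun t => s t ω)

/-- The event that the algorithm returns at some iteration `T ≤ B` and that the point it returns
satisfies `‖∇F‖ ≤ εg` and `λ_min(∇²F) ≥ -(ε + εH)`. -/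
def successEvent {d : ℕ} (εg εH ε B : ℝ) (F : Vec d → ℝ) (H : ℕ → Ω → Op d)
    (x : ℕ → Ω → Vec d) : Set Ω :=
  {ω | ∃ T : ℕ, (T : ℝ) ≤ B ∧
    (∀ u < T, ¬ Stops εg εH F (H u ω) (x u ω)) ∧ Stops εg εH F (H T ω) (x T ω) ∧
    ‖gradient F (x T ω)‖ ≤ εg ∧ -(ε + εH) ≤ lamMin (hessian F (x T ω))}

end Sampling

end SubsampledARC

end

open SubsampledARC

namespace SubsampledARC

/-! ### Scalar inequalities for the hyperbolic cosine -/

/-! Two independent facts combine: with high probability every sampled Hessian met within the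
iteration budget is `ε`-accurate, and a run with accurate Hessians must stop within that budget.

Accuracy is a matrix Hoeffding bound proved with the potential `tr cosh`. Adding a centred random
increment `X i - M`, where `‖X i‖ ≤ K ≤ 1`, multiplies the mean of `tr cosh` by at most `exp (K²)`
(`sum_traceCosh_step`). No Golden–Thompson or Lieb inequality is needed. In eigenbases of two
operators, the squared overlaps form a doubly stochastic array, so scalar tangent bounds for `cosh`
become trace bounds: Klein's inequality from below and a second-order remainder from above.
Expanding at `S - M` makes the increment `X i` rather than `X i - M`, and Klein's inequality absorbs
the averaged linear term. Iteration over the draws, with recentring when there is no replacement,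
followed by Markov's inequality gives the sample size. For ridge functions, importance sampling
makes the reweighted Hessians unbiased and bounded by the average of the `K i`.

For an accurate Hessian, subspace minimality and the tolerance on `ε` give `3 ε ≤ σ ‖s‖` once `6 L ≤
σ` (`AccurateStep.three_mul_le`). The cubic term then dominates both the Taylor and the sampling
error, so the step is accepted; hence `σ` stays bounded. A step taken from a point of small gradient
decreases `F` by order `εH³`, by negative curvature. An accepted step landing at a point of large
gradient has `‖s‖²` at least of order `εg`, hence decreases `F` by order `εg^(3/2)`. The remaining
accepted steps go from large to small gradient and are paid for by an indicator in `potential`,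
while rejected steps are paid for by `log σ`. The potential thus bounds the number of iterations
(`IsARCRun.iterations_le`).

A union bound over that many iterations explains the choice of `δ₀` (`success_probability_ge`). -/

theorem sub_one_mul_exp_add_one_nonneg (y : ℝ) : 0 ≤ (y - 1) * Real.exp y + 1 := by
  have h1 := Real.add_one_le_exp (-y)
  have h2 : Real.exp (-y) * Real.exp y = 1 := by rw [← Real.exp_add]; simp
  nlinarith [Real.exp_pos y]

theorem one_sub_sq_div_six_le (y : ℝ) :
    1 - y ^ 2 / 6 ≤ (1 - y + y ^ 2 / 3) * Real.exp y := by
  set q : ℝ → ℝ := fun y => (1 - y + y ^ 2 / 3) * Real.exp y - 1 + y ^ 2 / 6 with hq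
  -- The derivative has the sign of `y`, so `q` has its minimum, zero, at the origin.
  have hd : ∀ y, HasDerivAt q ((y / 3) * ((y - 1) * Real.exp y + 1)) y := by
    intro y
    have h1 : HasDerivAt (fun y : ℝ => 1 - y + y ^ 2 / 3) (-1 + 2 * y / 3) y := by
      exact (((hasDerivAt_id' y).const_sub 1).fun_add
        (((hasDerivAt_id' y).fun_pow 2).div_const 3)).congr_deriv (by norm_num)
    exact (((h1.fun_mul (Real.hasDerivAt_exp y)).sub_const 1).fun_add
      (((hasDerivAt_id' y).fun_pow 2).div_const 6)).congr_deriv (by norm_num; ring)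
  have hc : Continuous q := by fun_prop
  have h0 : q 0 = 0 := by simp [hq]
  have hpos : 0 ≤ q y := by
    rcases le_total 0 y with h | h
    · have : MonotoneOn q (Set.Ici 0) := by
        refine monotoneOn_of_deriv_nonneg (convex_Ici 0) hc.continuousOn
          (fun z _ => (hd z).differentiableAt.differentiableWithinAt) fun z hz => ?_
        rw [(hd z).deriv]
        rw [interior_Ici] at hz
        have hz' : 0 < z := hz
        exact mul_nonneg (by positivity) (sub_one_mul_exp_add_one_nonneg z)
      rw [← h0]
      exact this (by simp) h h
    · have : AntitoneOn q (Set.Iic 0) := by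
        refine antitoneOn_of_deriv_nonpos (convex_Iic 0) hc.continuousOn
          (fun z _ => (hd z).differentiableAt.differentiableWithinAt) fun z hz => ?_
        rw [(hd z).deriv]
        rw [interior_Iic] at hz
        have hz' : z < 0 := hz
        exact mul_nonpos_of_nonpos_of_nonneg (by linarith) (sub_one_mul_exp_add_one_nonneg z)
      rw [← h0]
      exact this h (by simp) h
  simp only [hq] at hpos
  linarith

theorem exp_mul_one_sub_sq_le (h : ℝ) :
    Real.exp h * (1 - h ^ 2 / 6) ≤ 1 + h + h ^ 2 / 3 := by
  have h1 := one_sub_sq_div_six_le (-h)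
  have h2 : Real.exp (-h) * Real.exp h = 1 := by rw [← Real.exp_add]; simp
  have := mul_le_mul_of_nonneg_left h1 (Real.exp_pos h).le
  calc _ = Real.exp h * (1 - (-h) ^ 2 / 6) := by ring
    _ ≤ _ := this
    _ = (1 + h + h ^ 2 / 3) * (Real.exp (-h) * Real.exp h) := by ring
    _ = _ := by rw [h2, mul_one]

theorem cosh_eq_cosh_sub (a b : ℝ) :
    Real.cosh b = (Real.exp a * Real.exp (b - a) + Real.exp (-a) * Real.exp (-(b - a))) / 2 := by
  rw [Real.cosh_eq, ← Real.exp_add, ← Real.exp_add]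
  ring_nf

theorem cosh_tangent_le (a b : ℝ) :
    Real.cosh a + (b - a) * Real.sinh a ≤ Real.cosh b := by
  rw [cosh_eq_cosh_sub a b, Real.cosh_eq, Real.sinh_eq]
  have h1 := mul_le_mul_of_nonneg_left (Real.add_one_le_exp (b - a)) (Real.exp_pos a).le
  have h2 := mul_le_mul_of_nonneg_left (Real.add_one_le_exp (-(b - a))) (Real.exp_pos (-a)).le
  linarith

/-- The Taylor remainder is `(b - a)² ∫ (1 - t) cosh (a + t (b - a))`, and convexity of `cosh` gives
the endpoint weights 1/3 and 1/6. Each term has a factor depending on `a` alone or on `b` alone, so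
it can later be summed against overlaps. -/
theorem cosh_le_tangent_add (a b : ℝ) :
    Real.cosh b ≤ Real.cosh a + (b - a) * Real.sinh a
      + (b - a) ^ 2 * (Real.cosh a / 3 + Real.cosh b / 6) := by
  rw [cosh_eq_cosh_sub a b, Real.cosh_eq, Real.sinh_eq]
  have h1 := mul_le_mul_of_nonneg_left (exp_mul_one_sub_sq_le (b - a)) (Real.exp_pos a).le
  have h2 := mul_le_mul_of_nonneg_left (exp_mul_one_sub_sq_le (-(b - a))) (Real.exp_pos (-a)).le
  linarith

theorem abs_sinh_le_cosh (a : ℝ) : |Real.sinh a| ≤ Real.cosh a := by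
  rw [abs_le, Real.sinh_eq, Real.cosh_eq]
  constructor <;> linarith [Real.exp_pos a, Real.exp_pos (-a)]

/-! ### The trace of the hyperbolic cosine of a symmetric operator -/

variable {d : ℕ}

/-- `A` is a symmetric operator. -/
def IsSymm (A : Op d) : Prop := ∀ v w : Vec d, inner ℝ (A v) w = inner ℝ v (A w)

theorem isSymm_zero : IsSymm (0 : Op d) := fun v w => by simp

theorem IsSymm.add {A B : Op d} (hA : IsSymm A) (hB : IsSymm B) : IsSymm (A + B) := fun v w => by
  simp [inner_add_left, inner_add_right, hA v w, hB v w]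

theorem IsSymm.sub {A B : Op d} (hA : IsSymm A) (hB : IsSymm B) : IsSymm (A - B) := fun v w => by
  simp [inner_sub_left, inner_sub_right, hA v w, hB v w]

theorem IsSymm.smul {A : Op d} (hA : IsSymm A) (c : ℝ) : IsSymm (c • A) := fun v w => by
  simp [real_inner_smul_left, real_inner_smul_right, hA v w]

theorem isSymm_sum {ι : Type*} {X : ι → Op d} (T : Finset ι) (hX : ∀ i ∈ T, IsSymm (X i)) :
    IsSymm (∑ i ∈ T, X i) := fun v w => by
  simp only [_root_.sum_apply, sum_inner, inner_sum]
  exact Finset.sum_congr rfl fun i hi => hX i hi v w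

open Classical in
/-- The trace of `cosh A` for a symmetric operator `A`. -/
noncomputable def traceCosh (A : Op d) : ℝ :=
  if h : (A : Vec d →ₗ[ℝ] Vec d).IsSymmetric then
    ∑ i, Real.cosh (h.eigenvalues finrank_euclideanSpace_fin i) else 0

theorem exists_eigenbasis (A : Op d) (hA : IsSymm A) :
    ∃ (e : OrthonormalBasis (Fin d) ℝ (Vec d)) (a : Fin d → ℝ),
      (∀ i, A (e i) = a i • e i) ∧ traceCosh A = ∑ i, Real.cosh (a i) := by
  have h : (A : Vec d →ₗ[ℝ] Vec d).IsSymmetric := hA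
  refine ⟨h.eigenvectorBasis finrank_euclideanSpace_fin,
    h.eigenvalues finrank_euclideanSpace_fin, fun i => ?_, ?_⟩
  · exact h.apply_eigenvectorBasis finrank_euclideanSpace_fin i
  · rw [traceCosh, dif_pos h]

theorem inner_smul_eigenbasis {B : Op d} (hB : IsSymm B)
    {f : OrthonormalBasis (Fin d) ℝ (Vec d)} {b : Fin d → ℝ} (hf : ∀ i, B (f i) = b i • f i)
    (v : Vec d) (j : Fin d) : inner ℝ (f j) (B v) = b j * inner ℝ (f j) v := by
  rw [← hB, hf, real_inner_smul_left]

theorem sum_inner_sq (e : OrthonormalBasis (Fin d) ℝ (Vec d)) (v : Vec d) :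
    ∑ i, inner ℝ (e i) v ^ 2 = ‖v‖ ^ 2 := by
  simpa [sq_abs] using e.sum_sq_norm_inner_right v

/-! ### Trace inequalities from a pair of eigenbases -/

section TwoBases

variable {A B : Op d} {e f : OrthonormalBasis (Fin d) ℝ (Vec d)} {a b : Fin d → ℝ}

/-- With `sum_overlap_right`, the squared overlaps are doubly stochastic. -/
theorem sum_overlap_left (i : Fin d) : ∑ j, inner ℝ (f j) (e i) ^ 2 = (1 : ℝ) := by
  rw [sum_inner_sq]; simp

theorem sum_overlap_right (j : Fin d) : ∑ i, inner ℝ (f j) (e i) ^ 2 = (1 : ℝ) := by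
  simp_rw [real_inner_comm (e _) (f j)]
  rw [sum_inner_sq]; simp

theorem sum_overlap_mul_sub (hB : IsSymm B) (he : ∀ i, A (e i) = a i • e i)
    (hf : ∀ i, B (f i) = b i • f i) (i : Fin d) :
    ∑ j, inner ℝ (f j) (e i) ^ 2 * (b j - a i) = inner ℝ (e i) ((B - A) (e i)) := by
  rw [← f.sum_inner_mul_inner]
  refine Finset.sum_congr rfl fun j _ => ?_
  rw [sub_apply, inner_sub_right, inner_smul_eigenbasis hB hf, he,
    real_inner_smul_right, real_inner_comm (f j) (e i)]
  ring

/-- Since `⟨f j, (B - A) e i⟩ = (b j - a i) ⟨f j, e i⟩`, this is Parseval. Individual eigenvalue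
gaps need not be small; only their overlap-weighted squares are controlled by `‖B - A‖`. -/
theorem sum_overlap_mul_sq_left (hB : IsSymm B) (he : ∀ i, A (e i) = a i • e i)
    (hf : ∀ i, B (f i) = b i • f i) (i : Fin d) :
    ∑ j, inner ℝ (f j) (e i) ^ 2 * (b j - a i) ^ 2 = ‖(B - A) (e i)‖ ^ 2 := by
  rw [← sum_inner_sq f]
  refine Finset.sum_congr rfl fun j _ => ?_
  rw [sub_apply, inner_sub_right, inner_smul_eigenbasis hB hf, he,
    real_inner_smul_right]
  ring

theorem sum_overlap_mul_sq_right (hA : IsSymm A) (he : ∀ i, A (e i) = a i • e i)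
    (hf : ∀ i, B (f i) = b i • f i) (j : Fin d) :
    ∑ i, inner ℝ (f j) (e i) ^ 2 * (b j - a i) ^ 2 = ‖(B - A) (f j)‖ ^ 2 := by
  rw [← sum_inner_sq e]
  refine Finset.sum_congr rfl fun i _ => ?_
  rw [sub_apply, inner_sub_right, inner_smul_eigenbasis hA he, hf,
    real_inner_smul_right, real_inner_comm (f j) (e i)]
  ring

theorem sum_cosh_left (g : Fin d → ℝ) :
    ∑ i, g i = ∑ i, ∑ j, inner ℝ (f j) (e i) ^ 2 * g i := by
  refine Finset.sum_congr rfl fun i _ => ?_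
  rw [← Finset.sum_mul, sum_overlap_left, one_mul]

theorem sum_cosh_right (g : Fin d → ℝ) :
    ∑ j, g j = ∑ i, ∑ j, inner ℝ (f j) (e i) ^ 2 * g j := by
  rw [Finset.sum_comm]
  refine Finset.sum_congr rfl fun i _ => ?_
  rw [← Finset.sum_mul, sum_overlap_right, one_mul]

theorem sum_sinh_eq (hB : IsSymm B) (he : ∀ i, A (e i) = a i • e i)
    (hf : ∀ i, B (f i) = b i • f i) :
    ∑ i, Real.sinh (a i) * inner ℝ (e i) ((B - A) (e i))
      = ∑ i, ∑ j, inner ℝ (f j) (e i) ^ 2 * ((b j - a i) * Real.sinh (a i)) := by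
  refine Finset.sum_congr rfl fun i _ => ?_
  rw [← sum_overlap_mul_sub hB he hf, Finset.mul_sum]
  exact Finset.sum_congr rfl fun j _ => by ring

/-- Klein's inequality for `cosh`. -/
theorem sum_cosh_tangent_le (hB : IsSymm B) (he : ∀ i, A (e i) = a i • e i)
    (hf : ∀ i, B (f i) = b i • f i) :
    ∑ i, Real.cosh (a i) + ∑ i, Real.sinh (a i) * inner ℝ (e i) ((B - A) (e i))
      ≤ ∑ j, Real.cosh (b j) := by
  rw [sum_sinh_eq hB he hf, sum_cosh_left (e := e) (f := f) (fun i => Real.cosh (a i)),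
    sum_cosh_right (e := e) (f := f) (fun j => Real.cosh (b j)), ← Finset.sum_add_distrib]
  refine Finset.sum_le_sum fun i _ => ?_
  rw [← Finset.sum_add_distrib]
  refine Finset.sum_le_sum fun j _ => ?_
  rw [← mul_add]
  exact mul_le_mul_of_nonneg_left (cosh_tangent_le _ _) (sq_nonneg _)

theorem norm_apply_sq_le {X : Op d} {K : ℝ} (hX : ‖X‖ ≤ K)
    (e : OrthonormalBasis (Fin d) ℝ (Vec d)) (i : Fin d) : ‖X (e i)‖ ^ 2 ≤ K ^ 2 := by
  have h : ‖X (e i)‖ ≤ K := by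
    have := X.le_of_opNorm_le hX (e i)
    simpa using this
  exact pow_le_pow_left₀ (norm_nonneg _) h 2

/-- The second-order upper bound that complements Klein's inequality. -/
theorem sum_cosh_le_tangent_add (hA : IsSymm A) (hB : IsSymm B)
    (he : ∀ i, A (e i) = a i • e i) (hf : ∀ i, B (f i) = b i • f i) {K : ℝ}
    (hK : ‖B - A‖ ≤ K) :
    ∑ j, Real.cosh (b j) ≤ ∑ i, Real.cosh (a i)
      + ∑ i, Real.sinh (a i) * inner ℝ (e i) ((B - A) (e i))
      + K ^ 2 * ((∑ i, Real.cosh (a i)) / 3 + (∑ j, Real.cosh (b j)) / 6) := by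
  have hmain : ∑ j, Real.cosh (b j) ≤ ∑ i, Real.cosh (a i)
      + ∑ i, Real.sinh (a i) * inner ℝ (e i) ((B - A) (e i))
      + (∑ i, ∑ j, inner ℝ (f j) (e i) ^ 2 * ((b j - a i) ^ 2 * (Real.cosh (a i) / 3))
        + ∑ i, ∑ j, inner ℝ (f j) (e i) ^ 2 * ((b j - a i) ^ 2 * (Real.cosh (b j) / 6))) := by
    rw [sum_sinh_eq hB he hf, sum_cosh_left (e := e) (f := f) (fun i => Real.cosh (a i)),
      sum_cosh_right (e := e) (f := f) (fun j => Real.cosh (b j)), ← Finset.sum_add_distrib,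
      ← Finset.sum_add_distrib, ← Finset.sum_add_distrib]
    refine Finset.sum_le_sum fun i _ => ?_
    rw [← Finset.sum_add_distrib, ← Finset.sum_add_distrib, ← Finset.sum_add_distrib]
    refine Finset.sum_le_sum fun j _ => ?_
    rw [← mul_add, ← mul_add, ← mul_add]
    refine mul_le_mul_of_nonneg_left ?_ (sq_nonneg _)
    have := cosh_le_tangent_add (a i) (b j)
    linarith
  have h1 : ∑ i, ∑ j, inner ℝ (f j) (e i) ^ 2 * ((b j - a i) ^ 2 * (Real.cosh (a i) / 3))
      ≤ K ^ 2 * ((∑ i, Real.cosh (a i)) / 3) := by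
    rw [Finset.sum_div, Finset.mul_sum]
    refine Finset.sum_le_sum fun i _ => ?_
    simp_rw [← mul_assoc]
    rw [← Finset.sum_mul, sum_overlap_mul_sq_left hB he hf]
    exact mul_le_mul_of_nonneg_right (norm_apply_sq_le hK e i)
      (div_nonneg (Real.cosh_pos _).le (by norm_num))
  have h2 : ∑ i, ∑ j, inner ℝ (f j) (e i) ^ 2 * ((b j - a i) ^ 2 * (Real.cosh (b j) / 6))
      ≤ K ^ 2 * ((∑ j, Real.cosh (b j)) / 6) := by
    rw [Finset.sum_comm, Finset.sum_div, Finset.mul_sum]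
    refine Finset.sum_le_sum fun j _ => ?_
    simp_rw [← mul_assoc]
    rw [← Finset.sum_mul, sum_overlap_mul_sq_right hA he hf]
    exact mul_le_mul_of_nonneg_right (norm_apply_sq_le hK f j)
      (div_nonneg (Real.cosh_pos _).le (by norm_num))
  linarith

end TwoBases

theorem traceCosh_nonneg (A : Op d) : 0 ≤ traceCosh A := by
  rw [traceCosh]
  split_ifs
  · exact Finset.sum_nonneg fun i _ => (Real.cosh_pos _).le
  · exact le_rfl

theorem traceCosh_zero : traceCosh (0 : Op d) = d := by
  obtain ⟨e, a, he, hA⟩ := exists_eigenbasis (0 : Op d) isSymm_zero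
  have ha : ∀ i, a i = 0 := fun i => by
    have := he i
    simp only [zero_apply] at this
    exact (smul_eq_zero.mp this.symm).resolve_right (e.orthonormal.ne_zero i)
  simp [hA, ha]

/-- If all eigenvalues were below `r` in absolute value, the norm would be at most `r`. Evenness of
`cosh` treats both ends of the spectrum at once. -/
theorem cosh_le_traceCosh {A : Op d} (hA : IsSymm A) {r : ℝ} (hr : 0 ≤ r) (h : r < ‖A‖) :
    Real.cosh r ≤ traceCosh A := by
  obtain ⟨e, a, he, hT⟩ := exists_eigenbasis A hA
  obtain ⟨i, hi⟩ : ∃ i, r ≤ |a i| := by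
    by_contra! hcon
    refine absurd (A.opNorm_le_bound hr fun v => ?_) (not_le.mpr h)
    refine abs_le_of_sq_le_sq' ?_ (by positivity) |>.2
    rw [← sum_inner_sq e, mul_pow, ← sum_inner_sq e v, Finset.mul_sum]
    refine Finset.sum_le_sum fun i _ => ?_
    rw [inner_smul_eigenbasis hA he, mul_pow]
    refine mul_le_mul_of_nonneg_right ?_ (sq_nonneg _)
    rw [← sq_abs (a i)]
    exact pow_le_pow_left₀ (abs_nonneg _) (hcon i).le 2
  rw [hT]
  refine le_trans ?_ (Finset.single_le_sum (f := fun i => Real.cosh (a i))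
    (fun i _ => (Real.cosh_pos _).le) (Finset.mem_univ i))
  rw [Real.cosh_le_cosh, abs_of_nonneg hr]
  exact hi

theorem abs_sum_sinh_inner_le {e : OrthonormalBasis (Fin d) ℝ (Vec d)} {a : Fin d → ℝ} {X : Op d}
    {K : ℝ} (hX : ‖X‖ ≤ K) :
    |∑ i, Real.sinh (a i) * inner ℝ (e i) (X (e i))| ≤ K * ∑ i, Real.cosh (a i) := by
  rw [Finset.mul_sum]
  refine (Finset.abs_sum_le_sum_abs _ _).trans (Finset.sum_le_sum fun i _ => ?_)
  rw [abs_mul, mul_comm K]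
  refine mul_le_mul (abs_sinh_le_cosh _) ?_ (abs_nonneg _) (Real.cosh_pos _).le
  refine (abs_real_inner_le_norm _ _).trans ?_
  have := X.le_of_opNorm_le hX (e i)
  simpa using this

/-- Here `P`, `Q`, `R` stand for `tr cosh S`, `tr cosh (S - M)` and the averaged value after one
draw. Eliminating `Q` leaves a polynomial inequality in `K²`, the odd power being removed by `K ≤ (1
+ K²) / 2`. -/
theorem step_factor_le {K P Q R : ℝ} (hK0 : 0 ≤ K) (hK : K ≤ 1) (hP : 0 ≤ P)
    (hQ : Q * (1 - K ^ 2 / 6) ≤ P * (1 + K + K ^ 2 / 3))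
    (hR : R * (1 - K ^ 2 / 6) ≤ P + K ^ 2 / 3 * Q) : R ≤ Real.exp (K ^ 2) * P := by
  have hc : (5 : ℝ) / 6 ≤ 1 - K ^ 2 / 6 := by nlinarith
  set c := 1 - K ^ 2 / 6 with hcdef
  have hc0 : 0 < c := by linarith
  have h1 : R * c ^ 2 ≤ P * (c + K ^ 2 / 3 * (1 + K + K ^ 2 / 3)) := by
    have e1 := mul_le_mul_of_nonneg_right hR hc0.le
    have e2 := mul_le_mul_of_nonneg_left hQ (show (0 : ℝ) ≤ K ^ 2 / 3 by positivity)
    nlinarith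
  have h2 : c + K ^ 2 / 3 * (1 + K + K ^ 2 / 3) ≤ (1 + K ^ 2 + (K ^ 2) ^ 2 / 2) * c ^ 2 := by
    have e0 : 1 + K + K ^ 2 / 3 ≤ 1 + (1 + K ^ 2) / 2 + K ^ 2 / 3 := by nlinarith [sq_nonneg (K - 1)]
    have e1 := mul_le_mul_of_nonneg_left e0 (show (0 : ℝ) ≤ K ^ 2 / 3 by positivity)
    refine (add_le_add le_rfl e1).trans ?_
    have hy0 : 0 ≤ K ^ 2 := sq_nonneg K
    have hy1 : K ^ 2 ≤ 1 := by nlinarith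
    rw [hcdef]
    generalize K ^ 2 = y at hy0 hy1
    have : (1 + y + y ^ 2 / 2) * (1 - y / 6) ^ 2
        - (1 - y / 6 + y / 3 * (1 + (1 + y) / 2 + y / 3))
        = y * (1 / 3 - y * (1 / 12) - y ^ 2 * (5 / 36) + y ^ 3 / 72) := by ring
    nlinarith [mul_nonneg hy0 hy0, mul_nonneg (mul_nonneg hy0 hy0) hy0,
      mul_nonneg hy0 (show 0 ≤ 1 / 3 - y * (1 / 12) - y ^ 2 * (5 / 36) + y ^ 3 / 72 by
        have : 0 ≤ y ^ 3 := by positivity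
        nlinarith)]
  have h3 := Real.quadratic_le_exp_of_nonneg (sq_nonneg K)
  have h4 : R * c ^ 2 ≤ (Real.exp (K ^ 2) * P) * c ^ 2 := by
    calc _ ≤ _ := h1
      _ ≤ P * ((1 + K ^ 2 + (K ^ 2) ^ 2 / 2) * c ^ 2) := mul_le_mul_of_nonneg_left h2 hP
      _ ≤ P * (Real.exp (K ^ 2) * c ^ 2) := by gcongr
      _ = _ := by ring
  exact le_of_mul_le_mul_right h4 (by positivity)

/-- A crude bound suffices: `tr cosh (S - M)` enters the one-step estimate only with the small
factor `K² / 3`. -/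
theorem traceCosh_sub_mul_le {S M : Op d} (hS : IsSymm S) (hM : IsSymm M) {K : ℝ}
    (hK : ‖M‖ ≤ K) :
    traceCosh (S - M) * (1 - K ^ 2 / 6) ≤ traceCosh S * (1 + K + K ^ 2 / 3) := by
  obtain ⟨e, a, he, hT⟩ := exists_eigenbasis S hS
  obtain ⟨f, b, hf, hT'⟩ := exists_eigenbasis (S - M) (hS.sub hM)
  have h1 := sum_cosh_le_tangent_add hS (hS.sub hM) he hf (K := K) (by simpa using hK)
  have h2 := abs_le.mp (abs_sum_sinh_inner_le (e := e) (a := a) (X := S - M - S) (K := K)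
    (by simpa using hK))
  rw [hT, hT']
  linarith [h2.2]

/-- One step of sampling increases the expected trace of `cosh` by a factor at most `exp (K²)`. -/
theorem sum_traceCosh_step {ι : Type*} (T : Finset ι) (p : ι → ℝ) (X : ι → Op d)
    (hp : ∀ i ∈ T, 0 ≤ p i) (hp1 : ∑ i ∈ T, p i = 1) (hX : ∀ i ∈ T, IsSymm (X i)) {K : ℝ}
    (hK0 : 0 ≤ K) (hK1 : K ≤ 1) (hXK : ∀ i ∈ T, ‖X i‖ ≤ K) {S : Op d} (hS : IsSymm S) :
    ∑ i ∈ T, p i * traceCosh (S + (X i - ∑ k ∈ T, p k • X k))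
      ≤ Real.exp (K ^ 2) * traceCosh S := by
  set M : Op d := ∑ k ∈ T, p k • X k with hMdef
  have hM : IsSymm M := isSymm_sum T fun i hi => (hX i hi).smul _
  have hMK : ‖M‖ ≤ K := by
    calc ‖M‖ ≤ ∑ k ∈ T, p k * K := norm_sum_le_of_le _ fun i hi => by
          rw [norm_smul, Real.norm_of_nonneg (hp i hi)]
          exact mul_le_mul_of_nonneg_left (hXK i hi) (hp i hi)
      _ = K := by rw [← Finset.sum_mul, hp1, one_mul]
  refine step_factor_le hK0 hK1 (traceCosh_nonneg S) (traceCosh_sub_mul_le hS hM hMK) ?_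
  -- The expansion centre is `S - M`, so the increment is `X i`, of norm at most `K`; centring at
  -- `S` would only give the bound `2 K`.
  obtain ⟨e, a, he, hT⟩ := exists_eigenbasis (S - M) (hS.sub hM)
  set G : Op d → ℝ := fun Y => ∑ i, Real.sinh (a i) * inner ℝ (e i) (Y (e i)) with hG
  have hGM : ∑ i ∈ T, p i * G (X i) = G M := by
    simp only [hG, hMdef, sum_apply, smul_apply, inner_sum,
      real_inner_smul_right, Finset.mul_sum]
    rw [Finset.sum_comm]
    exact Finset.sum_congr rfl fun i _ => Finset.sum_congr rfl fun j _ => by ring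
  have hup : ∀ i ∈ T, traceCosh (S + (X i - M)) * (1 - K ^ 2 / 6)
      ≤ traceCosh (S - M) * (1 + K ^ 2 / 3) + G (X i) := by
    intro i hi
    have hB : IsSymm (S + (X i - M)) := hS.add ((hX i hi).sub hM)
    obtain ⟨f, b, hf, hT'⟩ := exists_eigenbasis _ hB
    have hd : S + (X i - M) - (S - M) = X i := by abel
    have h1 := sum_cosh_le_tangent_add (hS.sub hM) hB he hf (K := K) (by rw [hd]; exact hXK i hi)
    rw [hd] at h1
    rw [hT, hT']
    simp only [hG]
    linarith
  -- Klein's inequality from `S - M` to `S`: the averaged linear term is exactly its tangent term.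
  have hlow : traceCosh (S - M) + G M ≤ traceCosh S := by
    obtain ⟨f, b, hf, hT'⟩ := exists_eigenbasis S hS
    have h1 := sum_cosh_tangent_le hS he hf
    rw [hT, hT']
    simpa [hG] using h1
  calc (∑ i ∈ T, p i * traceCosh (S + (X i - M))) * (1 - K ^ 2 / 6)
      = ∑ i ∈ T, p i * (traceCosh (S + (X i - M)) * (1 - K ^ 2 / 6)) := by
        rw [Finset.sum_mul]; exact Finset.sum_congr rfl fun i _ => by ring
    _ ≤ ∑ i ∈ T, p i * (traceCosh (S - M) * (1 + K ^ 2 / 3) + G (X i)) :=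
        Finset.sum_le_sum fun i hi => mul_le_mul_of_nonneg_left (hup i hi) (hp i hi)
    _ = traceCosh (S - M) * (1 + K ^ 2 / 3) + G M := by
        simp_rw [mul_add (p _)]
        rw [Finset.sum_add_distrib, hGM, ← Finset.sum_mul, hp1, one_mul]
    _ ≤ traceCosh S + K ^ 2 / 3 * traceCosh (S - M) := by linarith

/-! ### Exponential moments of sample sums -/

theorem op_smul_sub (c : ℝ) (A B : Op d) : c • A - c • B = c • (A - B) := (smul_sub c A B).symm

theorem sum_fin_succ_fun {ι : Type*} [Fintype ι] [DecidableEq ι] {N : ℕ}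
    (g : (Fin (N + 1) → ι) → ℝ) : ∑ j, g j = ∑ i, ∑ j : Fin N → ι, g (Fin.cons i j) := by
  rw [← Fintype.sum_prod_type']
  exact (Fintype.sum_equiv (Fin.consEquiv fun _ => ι) _ _ fun _ => rfl).symm

/-- Sampling with replacement. -/
theorem sum_prod_mul_traceCosh_le {ι : Type*} [Fintype ι] [DecidableEq ι] (p : ι → ℝ)
    (X : ι → Op d) (hp : ∀ i, 0 ≤ p i) (hp1 : ∑ i, p i = 1) (hX : ∀ i, IsSymm (X i)) {K : ℝ}
    (hK0 : 0 ≤ K) (hK1 : K ≤ 1) (hXK : ∀ i, ‖X i‖ ≤ K) (N : ℕ) :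
    ∀ A : Op d, IsSymm A →
      ∑ j : Fin N → ι, (∏ k, p (j k)) * traceCosh (A + ∑ k, (X (j k) - ∑ l, p l • X l))
        ≤ Real.exp (N * K ^ 2) * traceCosh A := by
  have hM : IsSymm (∑ l, p l • X l) := isSymm_sum _ fun i _ => (hX i).smul _
  induction N with
  | zero => intro A _; simp
  | succ N ih =>
    intro A hA
    rw [sum_fin_succ_fun]
    calc _ = ∑ i, p i * ∑ j : Fin N → ι, (∏ k, p (j k)) *
          traceCosh (A + (X i - ∑ l, p l • X l) + ∑ k, (X (j k) - ∑ l, p l • X l)) := by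
          refine Finset.sum_congr rfl fun i _ => ?_
          rw [Finset.mul_sum]
          refine Finset.sum_congr rfl fun j _ => ?_
          rw [Fin.prod_univ_succ, Fin.sum_univ_succ]
          simp only [Fin.cons_zero, Fin.cons_succ]
          rw [mul_assoc, add_assoc]
      _ ≤ ∑ i, p i * (Real.exp (N * K ^ 2) * traceCosh (A + (X i - ∑ l, p l • X l))) :=
          Finset.sum_le_sum fun i _ => mul_le_mul_of_nonneg_left
            (ih _ (hA.add ((hX i).sub hM))) (hp i)
      _ = Real.exp (N * K ^ 2) * ∑ i, p i * traceCosh (A + (X i - ∑ l, p l • X l)) := by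
          rw [Finset.mul_sum]
          exact Finset.sum_congr rfl fun i _ => by ring
      _ ≤ Real.exp (N * K ^ 2) * (Real.exp (K ^ 2) * traceCosh A) :=
          mul_le_mul_of_nonneg_left (sum_traceCosh_step _ p X (fun i _ => hp i) hp1
            (fun i _ => hX i) hK0 hK1 (fun i _ => hXK i) hA) (Real.exp_pos _).le
      _ = _ := by
          rw [← mul_assoc, ← Real.exp_add]
          congr 2
          push_cast
          ring

/-- The mean of `X` over the finite set `T`. -/
noncomputable def setMean {ι : Type*} (X : ι → Op d) (T : Finset ι) : Op d :=
  ∑ l ∈ T, (1 / (T.card : ℝ)) • X l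

theorem isSymm_setMean {ι : Type*} {X : ι → Op d} {T : Finset ι} (hX : ∀ i ∈ T, IsSymm (X i)) :
    IsSymm (setMean X T) := isSymm_sum _ fun i hi => (hX i hi).smul _

theorem card_smul_setMean {ι : Type*} (X : ι → Op d) (T : Finset ι) (hT : T.Nonempty) :
    (T.card : ℝ) • setMean X T = ∑ l ∈ T, X l := by
  have : (T.card : ℝ) ≠ 0 := by exact_mod_cast hT.card_pos.ne'
  rw [setMean, ← Finset.smul_sum, smul_smul, mul_one_div_cancel this, one_smul]

theorem setMean_erase_sub {ι : Type*} [DecidableEq ι] (X : ι → Op d) {T : Finset ι} {i : ι}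
    (hi : i ∈ T) (hT : 1 < T.card) :
    setMean X (T.erase i) = setMean X T - (1 / ((T.card : ℝ) - 1)) • (X i - setMean X T) := by
  have hc : ((T.card : ℝ) - 1) ≠ 0 := by
    have : (1 : ℝ) < T.card := by exact_mod_cast hT
    linarith
  have hcard : ((T.erase i).card : ℝ) = (T.card : ℝ) - 1 := by
    rw [Finset.card_erase_of_mem hi, Nat.cast_sub (by omega)]; simp
  have hne : (T.erase i).Nonempty := by
    rw [← Finset.card_pos, Finset.card_erase_of_mem hi]; omega
  have h1 := card_smul_setMean X (T.erase i) hne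
  have h2 := card_smul_setMean X T ⟨i, hi⟩
  rw [hcard] at h1
  have h3 : ∑ l ∈ T.erase i, X l = ∑ l ∈ T, X l - X i := by
    rw [← Finset.sum_erase_add T _ hi]; abel
  have h4 : ((T.card : ℝ) - 1) • setMean X (T.erase i)
      = ((T.card : ℝ) - 1) • (setMean X T - (1 / ((T.card : ℝ) - 1)) • (X i - setMean X T)) := by
    rw [h1, h3, ← h2, smul_sub, smul_smul, mul_one_div_cancel hc, one_smul, sub_smul, one_smul]
    abel
  exact smul_right_injective _ hc h4

open Classical in
/-- Sampling without replacement from the finite set `T`. -/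
theorem sum_injective_traceCosh_le {ι : Type*} [Fintype ι] (X : ι → Op d)
    (hX : ∀ i, IsSymm (X i)) {K : ℝ} (hK0 : 0 ≤ K) (hK1 : K ≤ 1) (hXK : ∀ i, ‖X i‖ ≤ K) (N : ℕ) :
    ∀ (T : Finset ι) (A : Op d), N ≤ T.card → IsSymm A →
      ∑ j : Fin N → ι, (if Function.Injective j ∧ ∀ k, j k ∈ T then
          traceCosh (A + ∑ k, (X (j k) - setMean X T)) else 0)
        ≤ (T.card.descFactorial N : ℝ) * (Real.exp (N * K ^ 2) * traceCosh A) := by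
  induction N with
  | zero =>
    intro T A _ _
    have : Function.Injective (default : Fin 0 → ι) := Function.injective_of_subsingleton _
    simp [this]
  | succ N ih =>
    intro T A hN hA
    have hTpos : 0 < T.card := by omega
    have hTc : (0 : ℝ) < T.card := by exact_mod_cast hTpos
    -- After `i` is drawn, the mean of the remaining set moves by `-(X i - setMean X T) / (T.card -
    -- 1)`. Recentring the other `N` draws there leaves the coefficient `c` on the first deviation,
    -- and `0 ≤ c ≤ 1` means nothing is lost against replacement.
    set c : ℝ := 1 - N / ((T.card : ℝ) - 1) with hc
    have hNT : (N : ℝ) ≤ (T.card : ℝ) - 1 := by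
      have : ((N + 1 : ℕ) : ℝ) ≤ T.card := by exact_mod_cast hN
      push_cast at this
      linarith
    have hc1 : c ≤ 1 := by
      have : 0 ≤ (N : ℝ) / ((T.card : ℝ) - 1) :=
        div_nonneg (Nat.cast_nonneg _) ((Nat.cast_nonneg N).trans hNT)
      linarith
    have hc0 : 0 ≤ c := by
      have : (N : ℝ) / ((T.card : ℝ) - 1) ≤ 1 :=
        div_le_one_of_le₀ hNT ((Nat.cast_nonneg N).trans hNT)
      linarith
    have hMT : IsSymm (setMean X T) := isSymm_setMean fun i _ => hX i
    have hstep : ∀ i ∈ T, ∑ j : Fin N → ι,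
        (if Function.Injective (Fin.cons i j : Fin (N + 1) → ι) ∧
            ∀ k, (Fin.cons i j : Fin (N + 1) → ι) k ∈ T then
          traceCosh (A + ∑ k, (X ((Fin.cons i j : Fin (N + 1) → ι) k) - setMean X T)) else 0)
        ≤ ((T.card - 1).descFactorial N : ℝ) *
          (Real.exp (N * K ^ 2) * traceCosh (A + c • (X i - setMean X T))) := by
      intro i hi
      have hcard := Finset.card_erase_of_mem hi
      have h1 := ih (T.erase i) (A + c • (X i - setMean X T)) (by omega)
        (hA.add (((hX i).sub hMT).smul _))
      rw [hcard] at h1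
      refine le_trans (le_of_eq (Finset.sum_congr rfl fun j _ => ?_)) h1
      have hiff : (Function.Injective (Fin.cons i j : Fin (N + 1) → ι) ∧
          ∀ k, (Fin.cons i j : Fin (N + 1) → ι) k ∈ T) ↔
          (Function.Injective j ∧ ∀ k, j k ∈ T.erase i) := by
        rw [Fin.cons_injective_iff, Fin.forall_fin_succ]
        simp only [Fin.cons_zero, Fin.cons_succ, Finset.mem_erase, Set.mem_range, not_exists]
        grind
      simp only [hiff]
      refine if_congr Iff.rfl ?_ rfl
      rw [Fin.sum_univ_succ]
      simp only [Fin.cons_zero, Fin.cons_succ]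
      congr 1
      rw [add_assoc]
      congr 1
      simp only [Finset.sum_sub_distrib, Finset.sum_const, Finset.card_univ, Fintype.card_fin]
      rcases Nat.eq_zero_or_pos N with rfl | hNpos
      · simp [hc]
      · rw [setMean_erase_sub X hi (by omega), hc, ← Nat.cast_smul_eq_nsmul ℝ,
          ← Nat.cast_smul_eq_nsmul ℝ]
        module
    have hnot : ∀ i ∉ T, ∑ j : Fin N → ι,
        (if Function.Injective (Fin.cons i j : Fin (N + 1) → ι) ∧
            ∀ k, (Fin.cons i j : Fin (N + 1) → ι) k ∈ T then
          traceCosh (A + ∑ k, (X ((Fin.cons i j : Fin (N + 1) → ι) k) - setMean X T)) else 0)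
        = 0 := by
      intro i hi
      refine Finset.sum_eq_zero fun j _ => if_neg fun h => hi ?_
      simpa using h.2 0
    have havg : ∑ i ∈ T, (1 / (T.card : ℝ)) * traceCosh (A + c • (X i - setMean X T))
        ≤ Real.exp (K ^ 2) * traceCosh A := by
      have h1 := sum_traceCosh_step T (fun _ => 1 / (T.card : ℝ)) (fun i => c • X i)
        (fun _ _ => by positivity) (by simp [hTc.ne']) (fun i _ => (hX i).smul c)
        (mul_nonneg hc0 hK0) (by nlinarith) (fun i _ => by
          rw [norm_smul, Real.norm_of_nonneg hc0]
          exact mul_le_mul_of_nonneg_left (hXK i) hc0) hA (K := c * K)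
      have hm : ∑ k ∈ T, (1 / (T.card : ℝ)) • c • X k = c • setMean X T := by
        rw [setMean, Finset.smul_sum]
        exact Finset.sum_congr rfl fun i _ => smul_comm _ _ _
      simp only [hm, op_smul_sub] at h1
      refine h1.trans (mul_le_mul_of_nonneg_right (Real.exp_le_exp.mpr ?_) (traceCosh_nonneg _))
      exact pow_le_pow_left₀ (mul_nonneg hc0 hK0) (mul_le_of_le_one_left hK0 hc1) 2
    rw [sum_fin_succ_fun, ← Finset.sum_subset (Finset.subset_univ T) fun i _ hi => hnot i hi]
    calc _ ≤ ∑ i ∈ T, ((T.card - 1).descFactorial N : ℝ) *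
          (Real.exp (N * K ^ 2) * traceCosh (A + c • (X i - setMean X T))) :=
          Finset.sum_le_sum hstep
      _ = (T.card * (T.card - 1).descFactorial N : ℝ) * (Real.exp (N * K ^ 2) *
          ∑ i ∈ T, (1 / (T.card : ℝ)) * traceCosh (A + c • (X i - setMean X T))) := by
          rw [Finset.mul_sum, Finset.mul_sum]
          refine Finset.sum_congr rfl fun i _ => ?_
          field_simp
      _ ≤ (T.card * (T.card - 1).descFactorial N : ℝ) * (Real.exp (N * K ^ 2) *
          (Real.exp (K ^ 2) * traceCosh A)) := by gcongr
      _ = _ := by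
          have hdf : T.card.descFactorial (N + 1) = T.card * (T.card - 1).descFactorial N := by
            obtain ⟨m, hm⟩ : ∃ m, T.card = m + 1 := ⟨T.card - 1, by omega⟩
            rw [hm, Nat.succ_descFactorial_succ]; simp
          rw [hdf, ← mul_assoc (Real.exp _), ← Real.exp_add]
          push_cast
          ring_nf

/-! ### The deviation bound -/

open Classical in
-- Markov's inequality for `tr cosh`, unnormalized: the weights need not sum to one.
theorem sum_mul_indicator_norm_le {J : Type*} [Fintype J] {w : J → ℝ} (hw : ∀ j, 0 ≤ w j)
    {Z : J → Op d} (hZ : ∀ j, IsSymm (Z j)) {θ r B : ℝ} (hθ : 0 < θ) (hr : 0 ≤ r)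
    (hB : ∑ j, w j * traceCosh (θ • Z j) ≤ B) :
    (∑ j, w j * (if r < ‖Z j‖ then 1 else 0)) * Real.cosh (θ * r) ≤ B := by
  refine le_trans ?_ hB
  rw [Finset.sum_mul]
  refine Finset.sum_le_sum fun j _ => ?_
  rw [mul_assoc]
  refine mul_le_mul_of_nonneg_left ?_ (hw j)
  split_ifs with h
  · rw [one_mul]
    refine cosh_le_traceCosh ((hZ j).smul θ) (by positivity) ?_
    rw [norm_smul, Real.norm_of_nonneg hθ.le]
    exact mul_lt_mul_of_pos_left h hθ
  · simpa using traceCosh_nonneg _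

open Classical in
theorem sum_mul_indicator_average_le {ι : Type*} [Fintype ι] {N : ℕ} (hd : 0 < d)
    {w : (Fin N → ι) → ℝ} (hw : ∀ j, 0 ≤ w j) {X : ι → Op d} (hX : ∀ i, IsSymm (X i)) {M : Op d}
    (hM : IsSymm M) {K ε δ : ℝ} (hK : 0 ≤ K) (hXK : ∀ i, ‖X i‖ ≤ K) (hMK : ‖M‖ ≤ K)
    (hmgf : ∀ θ, 0 < θ → θ * K ≤ 1 →
      ∑ j, w j * traceCosh (θ • ∑ k, (X (j k) - M)) ≤ Real.exp (N * (θ * K) ^ 2) * d)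
    (hε : 0 < ε) (hδ : 0 < δ) (hδ1 : δ < 1)
    (hN : 4 * K ^ 2 / ε ^ 2 * Real.log (2 * d / δ) ≤ N) :
    ∑ j, w j * (if ε < ‖(1 / (N : ℝ)) • ∑ k, X (j k) - M‖ then 1 else 0) ≤ δ := by
  rcases le_or_gt (2 * K) ε with hKε | hKε
  -- Both the average and `M` have norm at most `K`, so a deviation above `ε` is impossible.
  · refine (Finset.sum_eq_zero fun j _ => ?_).trans_le hδ.le
    rw [if_neg, mul_zero]
    rw [not_lt]
    have h1 : ‖(1 / (N : ℝ)) • ∑ k, X (j k)‖ ≤ K := by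
      rw [norm_smul]
      rcases Nat.eq_zero_or_pos N with rfl | hNpos
      · simpa using hK
      · have hN' : (0 : ℝ) < N := by exact_mod_cast hNpos
        have h2 : ‖∑ k, X (j k)‖ ≤ N * K := by
          refine (norm_sum_le_of_le _ fun k _ => hXK (j k)).trans (le_of_eq ?_)
          simp
        rw [Real.norm_of_nonneg (by positivity)]
        calc _ ≤ 1 / (N : ℝ) * (N * K) := by gcongr
          _ = K := by field_simp
    linarith [norm_sub_le ((1 / (N : ℝ)) • ∑ k, X (j k)) M]
  · have hKpos : 0 < K := by linarith
    have hd' : (1 : ℝ) ≤ d := by exact_mod_cast hd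
    have hlog : 0 < Real.log (2 * d / δ) := Real.log_pos (by rw [lt_div_iff₀ hδ]; linarith)
    have hNpos : (0 : ℝ) < N := lt_of_lt_of_le (by positivity) hN
    -- This minimizes the exponent `N (θ K)² - θ N ε`, with value `-N ε² / (4 K²)`; the case
    -- assumption `ε < 2 K` is what gives `θ K ≤ 1`.
    set θ : ℝ := ε / (2 * K ^ 2) with hθ
    have hθpos : 0 < θ := by positivity
    have hθK : θ * K = ε / (2 * K) := by rw [hθ]; field_simp
    have hθK1 : θ * K ≤ 1 := by rw [hθK, div_le_one (by positivity)]; exact hKε.le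
    have h1 := sum_mul_indicator_norm_le hw
      (fun j => isSymm_sum Finset.univ fun k _ => (hX (j k)).sub hM) hθpos
      (r := N * ε) (by positivity) (hmgf θ hθpos hθK1)
    have heq : ∀ j : Fin N → ι, (ε < ‖(1 / (N : ℝ)) • ∑ k, X (j k) - M‖) ↔
        ((N : ℝ) * ε < ‖∑ k, (X (j k) - M)‖) := by
      intro j
      have : ∑ k, (X (j k) - M) = (N : ℝ) • ((1 / (N : ℝ)) • ∑ k, X (j k) - M) := by
        rw [smul_sub, smul_smul, mul_one_div_cancel hNpos.ne', one_smul, Finset.sum_sub_distrib]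
        simp [← Nat.cast_smul_eq_nsmul ℝ]
      rw [this, norm_smul, Real.norm_of_nonneg hNpos.le]
      exact (mul_lt_mul_iff_right₀ hNpos).symm
    simp only [heq]
    have hcosh : Real.exp (θ * (N * ε)) / 2 ≤ Real.cosh (θ * (N * ε)) := by
      rw [Real.cosh_eq]; linarith [Real.exp_pos (-(θ * (N * ε)))]
    set Q := ∑ j : Fin N → ι, w j * (if (N : ℝ) * ε < ‖∑ k, (X (j k) - M)‖ then 1 else 0) with hQ
    have hQ0 : 0 ≤ Q := Finset.sum_nonneg fun j _ => mul_nonneg (hw j) (by split_ifs <;> norm_num)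
    have hfin : 2 * d * Real.exp (N * (θ * K) ^ 2) ≤ δ * Real.exp (θ * (N * ε)) := by
      have h2 : 2 * d / δ ≤ Real.exp (θ * (N * ε) - N * (θ * K) ^ 2) := by
        rw [← Real.log_le_iff_le_exp (by positivity)]
        have h3 : θ * (N * ε) - N * (θ * K) ^ 2 = N * ε ^ 2 / (4 * K ^ 2) := by
          rw [hθK, hθ]; field_simp; ring
        rw [h3, le_div_iff₀ (by positivity)]
        calc _ = (4 * K ^ 2 / ε ^ 2 * Real.log (2 * d / δ)) * ε ^ 2 := by field_simp
          _ ≤ _ := by gcongr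
      rw [Real.exp_sub, div_le_div_iff₀ hδ (Real.exp_pos _)] at h2
      linarith
    have h4 : Q * (Real.exp (θ * (N * ε)) / 2) ≤ Real.exp (N * (θ * K) ^ 2) * d :=
      (mul_le_mul_of_nonneg_left hcosh hQ0).trans h1
    have h5 : Q * Real.exp (θ * (N * ε)) ≤ δ * Real.exp (θ * (N * ε)) := by linarith
    exact le_of_mul_le_mul_right h5 (Real.exp_pos _)

open Classical in
theorem iid_deviation_le {ι : Type*} [Fintype ι] {N : ℕ} (hd : 0 < d) {p : ι → ℝ}
    (hp : ∀ i, 0 ≤ p i) (hp1 : ∑ i, p i = 1) {X : ι → Op d} (hX : ∀ i, IsSymm (X i)) {K ε δ : ℝ}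
    (hK : 0 ≤ K) (hXK : ∀ i, ‖X i‖ ≤ K) (hε : 0 < ε) (hδ : 0 < δ) (hδ1 : δ < 1)
    (hN : 4 * K ^ 2 / ε ^ 2 * Real.log (2 * d / δ) ≤ N) :
    ∑ j : Fin N → ι, (∏ k, p (j k)) *
      (if ε < ‖(1 / (N : ℝ)) • ∑ k, X (j k) - ∑ i, p i • X i‖ then 1 else 0) ≤ δ := by
  refine sum_mul_indicator_average_le hd (fun j => Finset.prod_nonneg fun k _ => hp _) hX
    (isSymm_sum _ fun i _ => (hX i).smul _) hK hXK ?_ (fun θ hθ hθK => ?_) hε hδ hδ1 hN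
  · calc _ ≤ ∑ k, p k * K := norm_sum_le_of_le _ fun i _ => by
          rw [norm_smul, Real.norm_of_nonneg (hp i)]
          exact mul_le_mul_of_nonneg_left (hXK i) (hp i)
      _ = K := by rw [← Finset.sum_mul, hp1, one_mul]
  · have h := sum_prod_mul_traceCosh_le p (fun i => θ • X i) hp hp1 (fun i => (hX i).smul θ)
      (mul_nonneg hθ.le hK) hθK (fun i => by
        rw [norm_smul, Real.norm_of_nonneg hθ.le]
        exact mul_le_mul_of_nonneg_left (hXK i) hθ.le) N 0 isSymm_zero
    rw [traceCosh_zero] at h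
    have hm : ∑ k, p k • θ • X k = θ • ∑ k, p k • X k := by
      rw [Finset.smul_sum]
      exact Finset.sum_congr rfl fun i _ => smul_comm _ _ _
    simpa only [hm, op_smul_sub, zero_add, ← Finset.smul_sum] using h

open Classical in
theorem without_replacement_deviation_le {n N : ℕ} (hd : 0 < d) (hn : 0 < n) {X : Fin n → Op d}
    (hX : ∀ i, IsSymm (X i)) {K ε δ : ℝ} (hK : 0 ≤ K) (hXK : ∀ i, ‖X i‖ ≤ K) (hε : 0 < ε)
    (hδ : 0 < δ) (hδ1 : δ < 1) (hN : 4 * K ^ 2 / ε ^ 2 * Real.log (2 * d / δ) ≤ N) :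
    ∑ j : Fin N → Fin n,
      (if Function.Injective j then 1 / (n.descFactorial N : ℝ) else 0) *
      (if ε < ‖(1 / (N : ℝ)) • ∑ k, X (j k) - ∑ i, (1 / (n : ℝ)) • X i‖ then 1 else 0) ≤ δ := by
  have hn' : (0 : ℝ) < n := by exact_mod_cast hn
  -- With more draws than indices no sample is injective, and all weights vanish.
  rcases lt_or_ge n N with hlt | hNn
  · refine (Finset.sum_eq_zero fun j _ => ?_).trans_le hδ.le
    rw [if_neg, zero_mul]
    intro hj
    have := Fintype.card_le_of_injective j hj
    simp at this
    omega
  refine sum_mul_indicator_average_le hd (fun j => by split_ifs <;> positivity) hX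
    (isSymm_sum _ fun i _ => (hX i).smul _) hK hXK ?_ (fun θ hθ hθK => ?_) hε hδ hδ1 hN
  · calc _ ≤ ∑ k : Fin n, (1 / (n : ℝ)) * K := norm_sum_le_of_le _ fun i _ => by
          rw [norm_smul, Real.norm_of_nonneg (by positivity)]
          exact mul_le_mul_of_nonneg_left (hXK i) (by positivity)
      _ = K := by simp; field_simp
  · have h := sum_injective_traceCosh_le (fun i => θ • X i) (fun i => (hX i).smul θ)
      (mul_nonneg hθ.le hK) hθK (fun i => by
        rw [norm_smul, Real.norm_of_nonneg hθ.le]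
        exact mul_le_mul_of_nonneg_left (hXK i) hθ.le) N Finset.univ 0 (by simpa using hNn)
        isSymm_zero
    rw [traceCosh_zero] at h
    have hm : setMean (fun i => θ • X i) Finset.univ = θ • ∑ k, (1 / (n : ℝ)) • X k := by
      rw [setMean, Finset.smul_sum]
      refine Finset.sum_congr rfl fun i _ => ?_
      rw [smul_comm]; simp
    simp only [hm, op_smul_sub, zero_add, ← Finset.smul_sum, Finset.mem_univ, implies_true,
      and_true, Finset.card_univ, Fintype.card_fin] at h
    have hdf : (0 : ℝ) < n.descFactorial N := by
      exact_mod_cast Nat.descFactorial_pos.mpr hNn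
    rw [← div_le_iff₀' hdf, Finset.sum_div] at h
    refine le_trans (le_of_eq (Finset.sum_congr rfl fun j _ => ?_)) h
    split_ifs
    · rw [← Finset.smul_sum (r := 1 / (n : ℝ)), one_div_mul_eq_div]
    · simp

/-! ### Gradients, Hessians and Taylor bounds -/

theorem hasGradientAt_of_hasFDerivAt_innerSL {f : Vec d → ℝ} {v x : Vec d}
    (h : HasFDerivAt f (innerSL ℝ v) x) : HasGradientAt f v x := h

theorem HasGradientAt.hasFDerivAt_innerSL {f : Vec d → ℝ} {v x : Vec d}
    (h : HasGradientAt f v x) : HasFDerivAt f (innerSL ℝ v) x := h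

theorem HasGradientAt.hasDerivAt_line {f : Vec d → ℝ} {g x s : Vec d} {τ : ℝ}
    (h : HasGradientAt f g (x + τ • s)) :
    HasDerivAt (fun r : ℝ => f (x + r • s)) (inner ℝ g s) τ := by
  have hl : HasDerivAt (fun r : ℝ => x + r • s) s τ := by
    simpa using ((hasDerivAt_id τ).smul_const s).const_add x
  exact (HasGradientAt.hasFDerivAt_innerSL h).comp_hasDerivAt τ hl

theorem TwiceDifferentiable.hasGradientAt {F : Vec d → ℝ} (hF : TwiceDifferentiable F)
    (x : Vec d) : HasGradientAt F (gradient F x) x := (hF.1 x).hasGradientAt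

theorem TwiceDifferentiable.hasFDerivAt_gradient {F : Vec d → ℝ} (hF : TwiceDifferentiable F)
    (x : Vec d) : HasFDerivAt (gradient F) (hessian F x) x := (hF.2 x).hasFDerivAt

/-- Differentiability of the gradient is enough; the second derivative need not be continuous. -/
theorem isSymm_hessian {F : Vec d → ℝ} (hF : TwiceDifferentiable F) (x : Vec d) :
    IsSymm (hessian F x) := by
  set J : Vec d →L[ℝ] Vec d →L[ℝ] ℝ := innerSL ℝ with hJ
  have h1 : ∀ y, HasFDerivAt F (J (gradient F y)) y := fun y =>
    HasGradientAt.hasFDerivAt_innerSL (hF.hasGradientAt y)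
  have h2 : HasFDerivAt (fun y => J (gradient F y)) (J.comp (hessian F x)) x :=
    J.hasFDerivAt.comp x (hF.hasFDerivAt_gradient x)
  intro v w
  have h3 := second_derivative_symmetric h1 h2 v w
  rw [real_inner_comm (hessian F x w) v]
  exact h3

/-- Hessians of `F` on the segment `[x, x + s]` differ from the one at `x` as if `∇²F` were
`L`-Lipschitz. -/
def HessianLipschitzOnSegment (L : ℝ) (F : Vec d → ℝ) (x s : Vec d) : Prop :=
  ∀ y ∈ segment ℝ x (x + s), ‖hessian F y - hessian F x‖ ≤ L * ‖y - x‖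

theorem norm_sub_le_of_mem_segment_add {x s y : Vec d} (hy : y ∈ segment ℝ x (x + s)) :
    ‖y - x‖ ≤ ‖s‖ := by
  rw [segment_eq_image'] at hy
  obtain ⟨θ, hθ, rfl⟩ := hy
  simp only [add_sub_cancel_left, norm_smul]
  rw [Real.norm_of_nonneg hθ.1]
  exact mul_le_of_le_one_left (norm_nonneg _) hθ.2

theorem add_smul_mem_segment {x s : Vec d} {τ : ℝ} (h0 : 0 ≤ τ) (h1 : τ ≤ 1) :
    x + τ • s ∈ segment ℝ x (x + s) := by
  rw [segment_eq_image']
  exact ⟨τ, ⟨h0, h1⟩, by simp⟩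

theorem HessianLipschitzOnSegment.smul {L τ : ℝ} {F : Vec d → ℝ} {x s : Vec d}
    (h : HessianLipschitzOnSegment L F x s) (h0 : 0 ≤ τ) (h1 : τ ≤ 1) :
    HessianLipschitzOnSegment L F x (τ • s) := by
  intro y hy
  have hsub : segment ℝ x (x + τ • s) ⊆ segment ℝ x (x + s) :=
    (convex_segment x (x + s)).segment_subset (left_mem_segment ℝ x (x + s))
      (add_smul_mem_segment h0 h1)
  exact h y (hsub hy)

theorem norm_gradient_taylor_le {F : Vec d → ℝ} (hF : TwiceDifferentiable F) {L : ℝ} (hL : 0 ≤ L)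
    {x s : Vec d} (h : HessianLipschitzOnSegment L F x s) :
    ‖gradient F (x + s) - gradient F x - hessian F x s‖ ≤ L * ‖s‖ ^ 2 := by
  have h1 := (convex_segment x (x + s)).norm_image_sub_le_of_norm_hasFDerivWithin_le
    (f := fun y => gradient F y - hessian F x y) (f' := fun y => hessian F y - hessian F x)
    (C := L * ‖s‖) (x := x) (y := x + s)
    (fun y _ => ((hF.hasFDerivAt_gradient y).sub (hessian F x).hasFDerivAt).hasFDerivWithinAt)
    (fun y hy => (h y hy).trans
      (mul_le_mul_of_nonneg_left (norm_sub_le_of_mem_segment_add hy) hL))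
    (left_mem_segment _ _ _) (right_mem_segment _ _ _)
  simp only [map_add, add_sub_cancel_left] at h1
  calc _ = ‖gradient F (x + s) - (hessian F x x + hessian F x s)
        - (gradient F x - hessian F x x)‖ := by congr 1; abel
    _ ≤ _ := h1
    _ = _ := by ring

/-- The mean value inequality is applied to the remainder along the segment. The constant is `L`
rather than `L / 6`, which the threshold `6 L ≤ σ` can afford. -/
theorem abs_taylor_le {F : Vec d → ℝ} (hF : TwiceDifferentiable F) {L : ℝ} (hL : 0 ≤ L)
    {x s : Vec d} (h : HessianLipschitzOnSegment L F x s) :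
    |F (x + s) - F x - inner ℝ (gradient F x) s - (1 / 2) * inner ℝ s (hessian F x s)|
      ≤ L * ‖s‖ ^ 3 := by
  set A := hessian F x
  set g := gradient F x
  have hd : ∀ τ : ℝ, HasDerivAt
      (fun r : ℝ => F (x + r • s) - r * inner ℝ g s - r ^ 2 / 2 * inner ℝ s (A s))
      (inner ℝ (gradient F (x + τ • s)) s - 1 * inner ℝ g s - τ * inner ℝ s (A s)) τ := by
    intro τ
    have h3 : HasDerivAt (fun r : ℝ => r ^ 2 / 2) τ τ :=
      (((hasDerivAt_id' τ).fun_pow 2).div_const 2).congr_deriv (by norm_num)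
    exact ((HasGradientAt.hasDerivAt_line (hF.hasGradientAt _)).fun_sub
      ((hasDerivAt_id' τ).mul_const _)).fun_sub (h3.mul_const _)
  have h1 := norm_image_sub_le_of_norm_deriv_le_segment_01' (C := L * ‖s‖ ^ 3)
    (fun τ _ => (hd τ).hasDerivWithinAt) (fun τ hτ => by
      have hg := norm_gradient_taylor_le hF hL (h.smul hτ.1 hτ.2.le)
      have he : inner ℝ (gradient F (x + τ • s)) s - 1 * inner ℝ g s - τ * inner ℝ s (A s)
          = inner ℝ (gradient F (x + τ • s) - g - A (τ • s)) s := by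
        rw [inner_sub_left, inner_sub_left, map_smul, real_inner_smul_left, one_mul,
          real_inner_comm s (A s)]
      rw [he]
      refine (norm_inner_le_norm _ _).trans ?_
      have hτs : ‖τ • s‖ ≤ ‖s‖ := by
        rw [norm_smul, Real.norm_of_nonneg hτ.1]
        exact mul_le_of_le_one_left (norm_nonneg _) hτ.2.le
      calc _ ≤ L * ‖τ • s‖ ^ 2 * ‖s‖ := by gcongr
        _ ≤ L * ‖s‖ ^ 2 * ‖s‖ := by gcongr
        _ = _ := by ring)
  simp only [one_smul, zero_smul, add_zero, one_mul, one_pow, zero_mul, sub_zero] at h1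
  rw [← Real.norm_eq_abs]
  refine le_trans (le_of_eq ?_) h1
  congr 1
  ring

theorem norm_gradient_sub_le {F : Vec d → ℝ} (hF : TwiceDifferentiable F) {K : ℝ}
    (hK : ∀ y, ‖hessian F y‖ ≤ K) (x s : Vec d) :
    ‖gradient F (x + s) - gradient F x‖ ≤ K * ‖s‖ := by
  have := convex_univ.norm_image_sub_le_of_norm_hasFDerivWithin_le
    (f := gradient F) (f' := hessian F) (C := K) (x := x) (y := x + s)
    (fun y _ => (hF.hasFDerivAt_gradient y).hasFDerivWithinAt) (fun y _ => hK y)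
    (Set.mem_univ _) (Set.mem_univ _)
  simpa using this

/-! ### The smallest eigenvalue -/

theorem lamMin_mul_norm_sq_le (H : Op d) (v : Vec d) : lamMin H * ‖v‖ ^ 2 ≤ inner ℝ v (H v) := by
  rcases eq_or_ne v 0 with rfl | hv
  · simp
  have hbdd : BddBelow (Set.range fun v : {v : Vec d // v ≠ 0} => H.rayleighQuotient (v : Vec d)) :=
    ⟨-‖H‖, by
      rintro _ ⟨w, rfl⟩
      exact (abs_le.mp (H.rayleighQuotient_le_norm (w : Vec d))).1⟩
  have h := ciInf_le hbdd ⟨v, hv⟩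
  have hn : 0 < ‖v‖ ^ 2 := by positivity
  rw [← le_div_iff₀ hn]
  refine h.trans (le_of_eq ?_)
  simp only [ContinuousLinearMap.rayleighQuotient, ContinuousLinearMap.reApplyInnerSelf_apply]
  rw [real_inner_comm]
  rfl

theorem le_lamMin (hd : 0 < d) {H : Op d} {c : ℝ} (h : ∀ v, c * ‖v‖ ^ 2 ≤ inner ℝ v (H v)) :
    c ≤ lamMin H := by
  have : Nonempty {v : Vec d // v ≠ 0} := by
    refine ⟨⟨EuclideanSpace.single ⟨0, hd⟩ (1 : ℝ), fun h => ?_⟩⟩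
    have := congrArg norm h
    simp at this
  refine le_ciInf fun v => ?_
  have hn : 0 < ‖(v : Vec d)‖ ^ 2 := by
    have := norm_pos_iff.mpr v.2
    positivity
  simp only [ContinuousLinearMap.rayleighQuotient, ContinuousLinearMap.reApplyInnerSelf_apply]
  rw [le_div_iff₀ hn, real_inner_comm]
  exact h v

theorem abs_inner_apply_le {X : Op d} {ε : ℝ} (hX : ‖X‖ ≤ ε) (v : Vec d) :
    |inner ℝ v (X v)| ≤ ε * ‖v‖ ^ 2 := by
  refine (abs_real_inner_le_norm _ _).trans ?_
  calc ‖v‖ * ‖X v‖ ≤ ‖v‖ * (ε * ‖v‖) := by gcongr; exact X.le_of_opNorm_le hX v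
    _ = _ := by ring

theorem lamMin_sub_le (hd : 0 < d) {H G : Op d} {ε : ℝ} (h : ‖H - G‖ ≤ ε) :
    lamMin H - ε ≤ lamMin G := by
  refine le_lamMin hd fun v => ?_
  have h1 := lamMin_mul_norm_sq_le H v
  have h2 := (abs_le.mp (abs_inner_apply_le h v)).2
  rw [sub_apply, inner_sub_right] at h2
  linarith

/-! ### Minimizers of the cubic model over a subspace -/

theorem hasGradientAt_cubicModel (g : Vec d) {H : Op d} (hH : IsSymm H) (σ : ℝ) (s : Vec d) :
    HasGradientAt (cubicModel g H σ) (g + H s + (σ * ‖s‖) • s) s := by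
  apply hasGradientAt_of_hasFDerivAt_innerSL
  have h1 : HasFDerivAt (fun s : Vec d => inner ℝ g s) (innerSL ℝ g) s :=
    (innerSL ℝ g).hasFDerivAt
  have h2 := (hasFDerivAt_id s).inner ℝ (H.hasFDerivAt (x := s))
  have h3 : HasFDerivAt (fun s : Vec d => ‖s‖ ^ 3) ((3 * ‖s‖) • innerSL ℝ s) s := by
    have h := hasFDerivAt_norm_rpow s (p := 3) (by norm_num)
    norm_num at h
    exact_mod_cast h
  have h4 := (h1.fun_add (h2.const_mul (1 / 2))).fun_add (h3.const_mul (σ / 3))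
  refine h4.congr_fderiv ?_
  ext v
  have h5 : inner ℝ (H s) v = inner ℝ s (H v) := hH s v
  have h6 : inner ℝ v (H s) = inner ℝ s (H v) := by rw [real_inner_comm, h5]
  simp [h5, h6]
  ring

theorem gradient_cubicModel (g : Vec d) {H : Op d} (hH : IsSymm H) (σ : ℝ) (s : Vec d) :
    gradient (cubicModel g H σ) s = g + H s + (σ * ‖s‖) • s :=
  (hasGradientAt_cubicModel g hH σ s).gradient

section SubspaceMin

variable {g : Vec d} {H : Op d} {σ : ℝ} {s : Vec d} {P : Submodule ℝ (Vec d)}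

theorem inner_gradient_cubicModel_eq_zero (hH : IsSymm H) (hs : s ∈ P)
    (hmin : ∀ v ∈ P, cubicModel g H σ s ≤ cubicModel g H σ v) {v : Vec d} (hv : v ∈ P) :
    inner ℝ (g + H s + (σ * ‖s‖) • s) v = 0 := by
  have hd : HasDerivAt (fun r : ℝ => cubicModel g H σ (s + r • v))
      (inner ℝ (g + H s + (σ * ‖s‖) • s) v) 0 := by
    refine HasGradientAt.hasDerivAt_line ?_
    simpa using hasGradientAt_cubicModel g hH σ s
  refine IsLocalMin.hasDerivAt_eq_zero (Filter.Eventually.of_forall fun r => ?_) hd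
  simpa using hmin _ (P.add_mem hs (P.smul_mem r hv))

/-- Scale `v` to `u` with `‖u‖ = ‖s‖` and add the comparisons of `s` with `s + u` and `s - u`: the
linear terms cancel. By the parallelogram law the two cubes sum to at most `8 ‖s‖³`, whence the
factor 2. -/
theorem neg_two_mul_le_inner_of_min (hσ : 0 ≤ σ) (hs : s ∈ P)
    (hmin : ∀ v ∈ P, cubicModel g H σ s ≤ cubicModel g H σ v) {v : Vec d} (hv : v ∈ P)
    (hv0 : v ≠ 0) (hs0 : s ≠ 0) : -(2 * σ * ‖s‖) * ‖v‖ ^ 2 ≤ inner ℝ v (H v) := by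
  have hvn : 0 < ‖v‖ := norm_pos_iff.mpr hv0
  have hsn : 0 < ‖s‖ := norm_pos_iff.mpr hs0
  set τ := ‖s‖ / ‖v‖ with hτ
  have hτpos : 0 < τ := by positivity
  set u := τ • v with hu
  have hun : ‖u‖ = ‖s‖ := by
    rw [hu, norm_smul, Real.norm_of_nonneg hτpos.le, hτ]; field_simp
  have huP : u ∈ P := P.smul_mem _ hv
  have h1 := hmin _ (P.add_mem hs huP)
  have h2 := hmin _ (P.sub_mem hs huP)
  have hpar := parallelogram_law_with_norm ℝ s u
  have ha : ‖s + u‖ ≤ 2 * ‖s‖ := by linarith [norm_add_le s u]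
  have hb : ‖s - u‖ ≤ 2 * ‖s‖ := by linarith [norm_sub_le s u]
  have hcube : ‖s + u‖ ^ 3 + ‖s - u‖ ^ 3 ≤ 8 * ‖s‖ ^ 3 := by
    have e1 := mul_le_mul_of_nonneg_right ha (sq_nonneg ‖s + u‖)
    have e2 := mul_le_mul_of_nonneg_right hb (sq_nonneg ‖s - u‖)
    rw [hun] at hpar
    nlinarith
  have hquad : 0 ≤ inner ℝ u (H u) + 2 * σ * ‖s‖ ^ 3 := by
    simp only [cubicModel, map_add, map_sub, inner_add_left, inner_add_right, inner_sub_left,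
      inner_sub_right] at h1 h2
    have e3 := mul_le_mul_of_nonneg_left hcube (show 0 ≤ σ / 3 by positivity)
    linarith
  have hscale : inner ℝ u (H u) = τ ^ 2 * inner ℝ v (H v) := by
    rw [hu, map_smul, real_inner_smul_left, real_inner_smul_right]; ring
  have hs3 : 2 * σ * ‖s‖ ^ 3 = τ ^ 2 * (2 * σ * ‖s‖ * ‖v‖ ^ 2) := by
    rw [hτ]; field_simp
  rw [hscale, hs3, ← mul_add] at hquad
  have := nonneg_of_mul_nonneg_right hquad (by positivity)
  linarith

/-- Stationarity along `s` eliminates the quadratic term, and comparison with `-s` shows `⟨g, s⟩ ≤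
0`. -/
theorem cubicModel_neg_ge_of_min (hH : IsSymm H) (hs : s ∈ P)
    (hmin : ∀ v ∈ P, cubicModel g H σ s ≤ cubicModel g H σ v) :
    σ / 6 * ‖s‖ ^ 3 ≤ -cubicModel g H σ s := by
  have h1 := inner_gradient_cubicModel_eq_zero hH hs hmin hs
  have h2 := hmin _ (P.neg_mem hs)
  rw [inner_add_left, inner_add_left, real_inner_smul_left, real_inner_self_eq_norm_sq,
    hH s s] at h1
  simp only [cubicModel, map_neg, inner_neg_left, inner_neg_right, norm_neg] at h2 ⊢
  nlinarith

/-- Stationarity is tested against `g` itself, which is why `g` must lie in the subspace. -/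
theorem norm_gradient_le_of_min (hH : IsSymm H) {K : ℝ} (hHK : ‖H‖ ≤ K) (hσ : 0 ≤ σ) (hs : s ∈ P)
    (hmin : ∀ v ∈ P, cubicModel g H σ s ≤ cubicModel g H σ v) (hg : g ∈ P) :
    ‖g‖ ≤ K * ‖s‖ + σ * ‖s‖ ^ 2 := by
  rcases eq_or_ne g 0 with rfl | hg0
  · have : 0 ≤ K := (norm_nonneg _).trans hHK
    simp only [norm_zero]; positivity
  have h1 := inner_gradient_cubicModel_eq_zero hH hs hmin hg
  rw [inner_add_left, inner_add_left, real_inner_smul_left, real_inner_self_eq_norm_sq] at h1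
  have h2 := (abs_le.mp (abs_real_inner_le_norm (H s) g)).1
  have h3 := (abs_le.mp (abs_real_inner_le_norm s g)).1
  have h4 : ‖H s‖ ≤ K * ‖s‖ := H.le_of_opNorm_le hHK s
  have hgn : 0 < ‖g‖ := norm_pos_iff.mpr hg0
  have h5 := mul_le_mul_of_nonneg_left h3 (show 0 ≤ σ * ‖s‖ by positivity)
  have h6 := mul_le_mul_of_nonneg_right h4 hgn.le
  refine le_of_mul_le_mul_right ?_ hgn
  nlinarith

end SubspaceMin

/-! ### One iteration with an accurate Hessian -/

/-- The ranges of the parameters of the algorithm and of the tolerances. -/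
structure AdmissibleParams (L KH η ν ζ εg εH ε : ℝ) : Prop where
  L_pos : 0 < L
  KH_pos : 0 < KH
  η_pos : 0 < η
  η_lt : η < 1
  ν_pos : 0 < ν
  ζ_pos : 0 < ζ
  ζ_lt : ζ < 1 / 2
  εg_pos : 0 < εg
  εg_lt : εg < 1
  εH_pos : 0 < εH
  ε_pos : 0 < ε
  ε_le_bound : ε ≤ toleranceBound L KH η ν εg εH
  ε_le : ε ≤ ζ * εg

/-- An iteration at which the algorithm does not stop and the approximate Hessian is
`ε`-accurate. -/
structure AccurateStep (L KH ν ζ εg εH ε : ℝ) (F : Vec d → ℝ) (H : Op d) (σ : ℝ)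
    (x s : Vec d) : Prop where
  twice : TwiceDifferentiable F
  hess_le : ∀ y, ‖hessian F y‖ ≤ KH
  symm : IsSymm H
  norm_le : ‖H‖ ≤ KH
  lip : HessianLipschitzOnSegment L F x s
  close : ‖H - hessian F x‖ ≤ ε
  not_stops : ¬ Stops εg εH F H x
  approx : ApproxSolves KH ν ζ (gradient F x) H σ s

section Step

variable {L KH η ν ζ εg εH ε σ : ℝ} {F : Vec d → ℝ} {H : Op d} {x s : Vec d}

theorem lamMin_lt_of_not_stops (h : ¬ Stops εg εH F H x) (hg : ‖gradient F x‖ ≤ εg) :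
    lamMin H < -εH := by
  by_contra hcon
  exact h ⟨hg, not_lt.mp hcon⟩

theorem cauchy_descent_pos {g sC sE : Vec d} (hKH : 0 < KH) (hσ : 0 < σ) (hg : 0 < ‖g‖)
    (h : SufficientDescent KH ν g H σ s sC sE) : 0 < -cubicModel g H σ sC := by
  refine lt_of_lt_of_le ?_ ((le_max_right _ _).trans h.cauchy_descent)
  have h1 : 0 < min (‖g‖ / KH) (√(‖g‖ / σ)) :=
    lt_min (by positivity) (Real.sqrt_pos.mpr (by positivity))
  positivity

theorem eigen_descent_ge {g sC sE : Vec d} (hν : 0 < ν) (hεH : 0 < εH) {σmax : ℝ} (hσ : 0 < σ)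
    (hσm : σ ≤ σmax) (hlam : lamMin H < -εH)
    (h : SufficientDescent KH ν g H σ s sC sE) :
    ν ^ 3 / (6 * σmax ^ 2) * εH ^ 3 ≤ -cubicModel g H σ s := by
  have hneg : lamMin H < 0 := by linarith
  refine le_trans ?_ ((h.eigen_descent hneg).trans (h.eigen_le hneg))
  have habs : εH ≤ |lamMin H| := by rw [abs_of_neg hneg]; linarith
  calc ν ^ 3 / (6 * σmax ^ 2) * εH ^ 3 = ν * εH / 6 * (ν ^ 2 * εH ^ 2 / σmax ^ 2) := by
        have : 0 < σmax := by linarith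
        field_simp
    _ ≤ ν * |lamMin H| / 6 * (ν ^ 2 * |lamMin H| ^ 2 / σ ^ 2) := by gcongr
    _ ≤ _ := by gcongr; exact le_max_right _ _

theorem AccurateStep.model_neg (hp : AdmissibleParams L KH η ν ζ εg εH ε) (hσ : 0 < σ)
    (h : AccurateStep L KH ν ζ εg εH ε F H σ x s) :
    0 < -cubicModel (gradient F x) H σ s := by
  obtain ⟨sC, sE, P, hsd, -⟩ := h.approx
  rcases le_or_gt ‖gradient F x‖ εg with hg | hg
  · refine lt_of_lt_of_le ?_ (eigen_descent_ge hp.ν_pos hp.εH_pos hσ le_rfl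
      (lamMin_lt_of_not_stops h.not_stops hg) hsd)
    have := hp.ν_pos
    have := hp.εH_pos
    positivity
  · exact lt_of_lt_of_le (cauchy_descent_pos hp.KH_pos hσ (hp.εg_pos.trans hg) hsd) hsd.cauchy_le

theorem cubicModel_zero (g : Vec d) (H : Op d) (σ : ℝ) : cubicModel g H σ 0 = 0 := by
  simp [cubicModel]

/-- The square-root tolerance, cleared by squaring `12 ε + KH ≤ √(KH² + 8 L εg)`. -/
theorem tolerance_quadratic_le (hp : AdmissibleParams L KH η ν ζ εg εH ε) :
    144 * ε ^ 2 + 24 * ε * KH ≤ 8 * L * εg := by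
  have h1 := hp.ε_le_bound.trans (min_le_left _ _)
  have hL := hp.L_pos
  have hg := hp.εg_pos
  have hε := hp.ε_pos
  have hK := hp.KH_pos
  have hD : 0 ≤ √(KH ^ 2 + 8 * L * εg) - KH := by
    have : KH ≤ √(KH ^ 2 + 8 * L * εg) := Real.le_sqrt_of_sq_le (by
      have : 0 < L * εg := by positivity
      linarith)
    linarith
  have h2 : ε ≤ 1 / 12 * (√(KH ^ 2 + 8 * L * εg) - KH) :=
    h1.trans (mul_le_mul_of_nonneg_right (min_le_left _ _) hD)
  have h3 : 12 * ε + KH ≤ √(KH ^ 2 + 8 * L * εg) := by linarith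
  have h4 := Real.sq_sqrt (show 0 ≤ KH ^ 2 + 8 * L * εg by positivity)
  have h5 := pow_le_pow_left₀ (by positivity) h3 2
  nlinarith

theorem tolerance_curvature_le (hp : AdmissibleParams L KH η ν ζ εg εH ε) : 6 * ε ≤ ν * εH := by
  have h1 := hp.ε_le_bound.trans (min_le_right _ _)
  have h2 : min (1 / 6) ((1 - η) / 3) * ν * εH ≤ 1 / 6 * ν * εH := by
    have := hp.ν_pos
    have := hp.εH_pos
    gcongr
    exact min_le_left _ _
  linarith

/-- This makes the error `ε ‖s‖² / 2` of the quadratic term at most `σ ‖s‖³ / 6`. At small gradient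
the eigen direction gives `ν εH ≤ 2 σ ‖s‖`; at large gradient a short step would contradict
stationarity along the gradient. -/
theorem AccurateStep.three_mul_le (hp : AdmissibleParams L KH η ν ζ εg εH ε)
    (h : AccurateStep L KH ν ζ εg εH ε F H σ x s) (hσ : 6 * L ≤ σ) : 3 * ε ≤ σ * ‖s‖ := by
  have hL := hp.L_pos
  have hσ0 : 0 < σ := by linarith
  have hε := hp.ε_pos
  have hneg := h.model_neg hp hσ0
  obtain ⟨sC, sE, P, hsd, -, hsC, hsE, hs, hmin⟩ := h.approx
  rcases le_or_gt ‖gradient F x‖ εg with hg | hg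
  · have hlam := lamMin_lt_of_not_stops h.not_stops hg
    have hεH := hp.εH_pos
    have hneg' : lamMin H < 0 := by linarith
    obtain ⟨h1, h2⟩ := hsd.eigen_dir hneg'
    have hsE0 : sE ≠ 0 := by rintro rfl; simp at h2
    have hs0 : s ≠ 0 := by rintro rfl; simp [cubicModel_zero] at hneg
    have h3 := neg_two_mul_le_inner_of_min hσ0.le hs hmin (hsE hneg') hsE0 hs0
    have hn : 0 < ‖sE‖ ^ 2 := by have := norm_pos_iff.mpr hsE0; positivity
    have h4 := le_of_mul_le_mul_right (h3.trans h1) hn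
    have h5 := tolerance_curvature_le hp
    have h6 := mul_lt_mul_of_pos_left hlam hp.ν_pos
    linarith
  · by_contra! hcon
    have hgpos := hp.εg_pos.trans hg
    have hC := cauchy_descent_pos hp.KH_pos hσ0 hgpos hsd
    obtain ⟨α, hα, hαs⟩ := hsd.cauchy_dir
    have hα0 : α ≠ 0 := by
      rintro rfl
      rw [hαs] at hC
      simp [cubicModel_zero] at hC
    -- Positive Cauchy decrease forces `α ≠ 0`, so the subspace contains the gradient.
    have hgP : gradient F x ∈ P := by
      have h1 : α • gradient F x ∈ P := by
        have := P.neg_mem hsC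
        rwa [hαs, neg_neg] at this
      have h2 := P.smul_mem α⁻¹ h1
      rwa [smul_smul, inv_mul_cancel₀ hα0, one_smul] at h2
    have h1 := norm_gradient_le_of_min h.symm h.norm_le hσ0.le hs hmin hgP
    have h2 := tolerance_quadratic_le hp
    have hK := hp.KH_pos
    have hs0 := norm_nonneg s
    have h3 : σ * ‖gradient F x‖ ≤ KH * (σ * ‖s‖) + (σ * ‖s‖) ^ 2 := by
      have := mul_le_mul_of_nonneg_left h1 hσ0.le
      linarith
    have h4 : (σ * ‖s‖) ^ 2 ≤ (3 * ε) ^ 2 := pow_le_pow_left₀ (by positivity) hcon.le 2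
    have h5 : KH * (σ * ‖s‖) ≤ KH * (3 * ε) := mul_le_mul_of_nonneg_left hcon.le hK.le
    have h6 : L * εg ≤ L * ‖gradient F x‖ := by gcongr
    have h7 : 6 * L * ‖gradient F x‖ ≤ σ * ‖gradient F x‖ := by gcongr
    have h8 : 0 < L * ‖gradient F x‖ := by positivity
    nlinarith [sq_nonneg ε]

/-- The Taylor error and the Hessian error each use at most `σ ‖s‖³ / 6`, together exactly the cubic
term of the model; so the model overestimates `F (x + s) - F x`. -/
theorem AccurateStep.one_le_ratio (hp : AdmissibleParams L KH η ν ζ εg εH ε)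
    (h : AccurateStep L KH ν ζ εg εH ε F H σ x s) (hσ : 6 * L ≤ σ) : 1 ≤ ratio F H σ x s := by
  have hL := hp.L_pos
  have hσ0 : 0 < σ := by linarith
  have hneg := h.model_neg hp hσ0
  have h3 := h.three_mul_le hp hσ
  rw [ratio, le_div_iff₀ hneg, one_mul]
  have h1 := (abs_le.mp (abs_taylor_le h.twice hL.le h.lip)).2
  have h2 := (abs_le.mp (abs_inner_apply_le h.close s)).1
  rw [sub_apply, inner_sub_right] at h2
  have h4 : ε * ‖s‖ ^ 2 / 2 ≤ σ / 6 * ‖s‖ ^ 3 := by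
    have := mul_le_mul_of_nonneg_right h3 (sq_nonneg ‖s‖)
    linarith
  have h5 : 6 * L * ‖s‖ ^ 3 ≤ σ * ‖s‖ ^ 3 := by gcongr
  simp only [cubicModel]
  linarith

theorem mul_model_le_of_le_ratio (hm : 0 < -cubicModel (gradient F x) H σ s)
    (hρ : η ≤ ratio F H σ x s) :
    η * -cubicModel (gradient F x) H σ s ≤ F x - F (x + s) := by
  rwa [ratio, le_div_iff₀ hm] at hρ

/-- The new gradient is the model gradient plus Taylor, Hessian and cubic errors. For `‖s‖ < 1`, all
is of order `‖s‖²` except two multiples `ζ ‖∇F (x + s)‖`, one from the stopping rule and one from `ε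
≤ ζ εg`; these are absorbed because `ζ < 1 / 2`. -/
theorem AccurateStep.step_sq_ge (hp : AdmissibleParams L KH η ν ζ εg εH ε) {Kbar σmax : ℝ}
    (hK : KH ≤ Kbar) (hσ0 : 0 < σ) (hσ : σ ≤ σmax)
    (h : AccurateStep L KH ν ζ εg εH ε F H σ x s) (hg : εg < ‖gradient F (x + s)‖) :
    min 1 ((1 - 2 * ζ) / (L + σmax + ζ + ζ * Kbar)) * εg ≤ ‖s‖ ^ 2 := by
  have hεg := hp.εg_pos
  have hζ := hp.ζ_pos
  rcases le_or_gt 1 ‖s‖ with hs1 | hs1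
  · have h1 : min 1 ((1 - 2 * ζ) / (L + σmax + ζ + ζ * Kbar)) * εg ≤ 1 * εg := by
      gcongr
      exact min_le_left _ _
    have := hp.εg_lt
    nlinarith
  obtain ⟨sC, sE, P, -, hhalt, -⟩ := h.approx
  rw [GradientStopping, gradient_cubicModel _ h.symm, min_eq_right hs1.le] at hhalt
  set g := gradient F x
  set g' := gradient F (x + s)
  have hs0 := norm_nonneg s
  have h1 : ‖g' - g - hessian F x s‖ ≤ L * ‖s‖ ^ 2 :=
    norm_gradient_taylor_le h.twice hp.L_pos.le h.lip
  have h2 : ‖(H - hessian F x) s‖ ≤ ε * ‖s‖ := (H - hessian F x).le_of_opNorm_le h.close s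
  have h3 : ‖(σ * ‖s‖) • s‖ = σ * ‖s‖ ^ 2 := by
    rw [norm_smul, Real.norm_of_nonneg (by positivity)]; ring
  have h4 : ‖g'‖ ≤ ‖g' - g - hessian F x s‖ + ‖(H - hessian F x) s‖
      + ‖g + H s + (σ * ‖s‖) • s‖ + ‖(σ * ‖s‖) • s‖ := by
    have he : g' = (g' - g - hessian F x s) - (H - hessian F x) s + (g + H s + (σ * ‖s‖) • s)
        - (σ * ‖s‖) • s := by
      rw [sub_apply]; abel
    calc ‖g'‖ = ‖(g' - g - hessian F x s) - (H - hessian F x) s + (g + H s + (σ * ‖s‖) • s)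
        - (σ * ‖s‖) • s‖ := congrArg norm he
      _ ≤ _ := (norm_sub_le _ _).trans (add_le_add ((norm_add_le _ _).trans
        (add_le_add (norm_sub_le _ _) le_rfl)) le_rfl)
  have h5 : ‖g‖ ≤ ‖g'‖ + KH * ‖s‖ := by
    have e1 := norm_gradient_sub_le h.twice h.hess_le x s
    have e2 := norm_sub_norm_le g g'
    rw [norm_sub_rev] at e2
    linarith
  have h6 : max (‖s‖ ^ 2) (‖s‖ * ‖g‖) ≤ ‖s‖ ^ 2 + (‖g'‖ + KH * ‖s‖ ^ 2) := by
    refine max_le (by have := hp.KH_pos; nlinarith [norm_nonneg g', sq_nonneg ‖s‖]) ?_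
    have e1 := mul_le_mul_of_nonneg_left h5 hs0
    have e2 := mul_le_mul_of_nonneg_right hs1.le (norm_nonneg g')
    nlinarith [sq_nonneg ‖s‖]
  have h7 := hhalt.trans (mul_le_mul_of_nonneg_left h6 hζ.le)
  have h8 : ε * ‖s‖ ≤ ζ * ‖g'‖ := by
    calc ε * ‖s‖ ≤ ε * 1 := mul_le_mul_of_nonneg_left hs1.le hp.ε_pos.le
      _ ≤ ζ * εg := by rw [mul_one]; exact hp.ε_le
      _ ≤ ζ * ‖g'‖ := mul_le_mul_of_nonneg_left hg.le hζ.le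
  have h9 : (1 - 2 * ζ) * ‖g'‖ ≤ (L + σmax + ζ + ζ * Kbar) * ‖s‖ ^ 2 := by
    have e1 : σ * ‖s‖ ^ 2 ≤ σmax * ‖s‖ ^ 2 := by gcongr
    have e2 : ζ * KH * ‖s‖ ^ 2 ≤ ζ * Kbar * ‖s‖ ^ 2 := by gcongr
    rw [h3] at h4
    linarith
  have hc : 0 < L + σmax + ζ + ζ * Kbar := by
    have := hp.L_pos
    have : 0 < Kbar := hp.KH_pos.trans_le hK
    have : 0 < σmax := hσ0.trans_le hσ
    positivity
  have hζ' : 0 < 1 - 2 * ζ := by linarith [hp.ζ_lt]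
  calc _ ≤ (1 - 2 * ζ) / (L + σmax + ζ + ζ * Kbar) * εg := by gcongr; exact min_le_right _ _
    _ ≤ (1 - 2 * ζ) / (L + σmax + ζ + ζ * Kbar) * ‖g'‖ := by gcongr
    _ = (1 - 2 * ζ) * ‖g'‖ / (L + σmax + ζ + ζ * Kbar) := by ring
    _ ≤ ‖s‖ ^ 2 := by rw [div_le_iff₀ hc]; linarith

theorem AccurateStep.model_ge_of_gradient (hp : AdmissibleParams L KH η ν ζ εg εH ε)
    {Kbar σmin σmax : ℝ} (hK : KH ≤ Kbar) (hσmin : 0 < σmin) (hσ0 : σmin ≤ σ) (hσ : σ ≤ σmax)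
    (h : AccurateStep L KH ν ζ εg εH ε F H σ x s) (hg : εg < ‖gradient F (x + s)‖) :
    σmin / 6 * min 1 ((1 - 2 * ζ) / (L + σmax + ζ + ζ * Kbar)) ^ (3 / 2 : ℝ)
      * εg ^ (3 / 2 : ℝ) ≤ -cubicModel (gradient F x) H σ s := by
  have h1 := h.step_sq_ge hp hK (hσmin.trans_le hσ0) hσ hg
  have hεg := hp.εg_pos
  set q := min 1 ((1 - 2 * ζ) / (L + σmax + ζ + ζ * Kbar))
  have hq : 0 ≤ q := by
    have := hp.ζ_pos
    have := hp.ζ_lt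
    have := hp.L_pos
    have : 0 < Kbar := hp.KH_pos.trans_le hK
    have : 0 < σmax := by linarith
    exact le_min zero_le_one (div_nonneg (by linarith) (by positivity))
  obtain ⟨sC, sE, P, -, -, -, -, hs, hmin⟩ := h.approx
  refine le_trans ?_ (cubicModel_neg_ge_of_min h.symm hs hmin)
  have h2 : q ^ (3 / 2 : ℝ) * εg ^ (3 / 2 : ℝ) ≤ ‖s‖ ^ 3 := by
    rw [← Real.mul_rpow hq hεg.le]
    calc (q * εg) ^ (3 / 2 : ℝ) ≤ (‖s‖ ^ 2) ^ (3 / 2 : ℝ) :=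
          Real.rpow_le_rpow (by positivity) h1 (by norm_num)
      _ = ‖s‖ ^ 3 := by
          rw [← Real.rpow_natCast, ← Real.rpow_natCast, ← Real.rpow_mul (norm_nonneg _)]
          norm_num
  calc _ = σmin / 6 * (q ^ (3 / 2 : ℝ) * εg ^ (3 / 2 : ℝ)) := by ring
    _ ≤ σ / 6 * ‖s‖ ^ 3 := by
      have : 0 ≤ σ := hσmin.le.trans hσ0
      gcongr

end Step

/-! ### The number of iterations -/

section Run

variable {L KH η γ ν ζ εg εH ε σmin σ₀ σmax Kbar D : ℝ} {F : Vec d → ℝ} {x₀ : Vec d}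
  {H : ℕ → Op d} {x s : ℕ → Vec d} {σ : ℕ → ℝ}

/-- Rejection requires `σ t < 6 L`, so an increase by `γ` cannot pass `6 γ L`. -/
theorem IsARCRun.sigma_mem (hp : AdmissibleParams L KH η ν ζ εg εH ε) (hγ : 1 < γ)
    (hσmin : 0 < σmin) (hσ₀ : σmin ≤ σ₀) (hmax : max σ₀ (6 * γ * L) ≤ σmax)
    (hrun : IsARCRun εg εH η γ σmin KH ν ζ F x₀ σ₀ H x s σ) {T : ℕ}
    (hacc : ∀ t < T, AccurateStep L KH ν ζ εg εH ε F (H t) (σ t) (x t) (s t))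
    (hR : ∀ t < T, Running εg εH F H x t) :
    ∀ t ≤ T, σmin ≤ σ t ∧ σ t ≤ σmax := by
  intro t
  induction t with
  | zero =>
    intro _
    rw [hrun.init_σ]
    exact ⟨hσ₀, (le_max_left _ _).trans hmax⟩
  | succ t ih =>
    intro ht
    obtain ⟨h1, h2⟩ := ih (by omega)
    have hσt : 0 < σ t := by linarith
    rcases le_or_gt η (ratio F (H t) (σ t) (x t) (s t)) with hρ | hρ
    · rw [(hrun.accept t (hR t (by omega)) hρ).2]
      exact ⟨le_max_right _ _, max_le ((div_le_self hσt.le hγ.le).trans h2) (h1.trans h2)⟩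
    · rw [(hrun.reject t (hR t (by omega)) hρ).2]
      have hlt : σ t < 6 * L := by
        by_contra! hcon
        have := (hacc t (by omega)).one_le_ratio hp hcon
        linarith [hp.η_lt]
      refine ⟨by nlinarith, le_trans ?_ ((le_max_right _ _).trans hmax)⟩
      nlinarith

open Classical in
/-- The potential that decreases by at least one at every iteration. -/
noncomputable def potential (γ εg D : ℝ) (F : Vec d → ℝ) (x : Vec d) (σ : ℝ) : ℝ :=
  2 * (2 * F x / D + if εg < ‖gradient F x‖ then 1 else 0) - Real.log σ / Real.log γ

/-- A rejection raises `log σ / log γ` by one and leaves `x` fixed. An acceptance lowers it by at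
most one, so the bracket, which has weight 2, must fall by at least one. -/
theorem IsARCRun.potential_succ_le (hp : AdmissibleParams L KH η ν ζ εg εH ε) (hγ : 1 < γ)
    (hσmin : 0 < σmin) (hK : KH ≤ Kbar) (hD : 0 < D)
    (hD1 : D ≤ η * (ν ^ 3 / (6 * σmax ^ 2) * εH ^ 3))
    (hD2 : D ≤ η * (σmin / 6 * min 1 ((1 - 2 * ζ) / (L + σmax + ζ + ζ * Kbar)) ^ (3 / 2 : ℝ)
      * εg ^ (3 / 2 : ℝ)))
    (hrun : IsARCRun εg εH η γ σmin KH ν ζ F x₀ σ₀ H x s σ) {t : ℕ}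
    (hacc : AccurateStep L KH ν ζ εg εH ε F (H t) (σ t) (x t) (s t))
    (hR : Running εg εH F H x t) (hσ1 : σmin ≤ σ t) (hσ2 : σ t ≤ σmax) :
    potential γ εg D F (x (t + 1)) (σ (t + 1)) ≤ potential γ εg D F (x t) (σ t) - 1 := by
  have hσt : 0 < σ t := by linarith
  have hlogγ : 0 < Real.log γ := Real.log_pos hγ
  have hγ0 : 0 < γ := by linarith
  rcases le_or_gt η (ratio F (H t) (σ t) (x t) (s t)) with hρ | hρ
  · obtain ⟨hx, hσ⟩ := hrun.accept t hR hρ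
    have hneg := hacc.model_neg hp hσt
    have hdec := mul_model_le_of_le_ratio hneg hρ
    have hη := hp.η_pos
    have hlog : Real.log (σ t) / Real.log γ - 1 ≤ Real.log (σ (t + 1)) / Real.log γ := by
      have h1 : Real.log (σ t / γ) ≤ Real.log (σ (t + 1)) :=
        Real.log_le_log (by positivity) (by rw [hσ]; exact le_max_left _ _)
      rw [Real.log_div hσt.ne' hγ0.ne'] at h1
      rw [div_sub_one hlogγ.ne']
      gcongr
    have hF0 : F (x t + s t) ≤ F (x t) := by
      have : 0 ≤ η * -cubicModel (gradient F (x t)) (H t) (σ t) (s t) := by positivity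
      linarith
    have hkey : 2 * F (x t + s t) / D + (if εg < ‖gradient F (x t + s t)‖ then 1 else 0) ≤
        2 * F (x t) / D + (if εg < ‖gradient F (x t)‖ then 1 else 0) - 1 := by
      -- A drop of `D` lowers `2 F / D` by 2, enough even if the indicator rises. Without it, the
      -- two decrease estimates force a passage from large to small gradient, so the indicator
      -- falls.
      by_cases hdrop : D ≤ F (x t) - F (x t + s t)
      · have h1 : 2 * F (x t + s t) / D ≤ 2 * F (x t) / D - 2 := by
          rw [div_sub' hD.ne', div_le_div_iff_of_pos_right hD]; linarith
        split_ifs <;> linarith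
      · have hg : εg < ‖gradient F (x t)‖ := by
          by_contra! hcon
          obtain ⟨sC, sE, P, hsd, -⟩ := hacc.approx
          have := eigen_descent_ge hp.ν_pos hp.εH_pos hσt hσ2
            (lamMin_lt_of_not_stops hacc.not_stops hcon) hsd
          exact hdrop (hD1.trans ((mul_le_mul_of_nonneg_left this hη.le).trans hdec))
        have hg' : ¬ εg < ‖gradient F (x t + s t)‖ := by
          intro hcon
          have := hacc.model_ge_of_gradient hp hK hσmin hσ1 hσ2 hcon
          exact hdrop (hD2.trans ((mul_le_mul_of_nonneg_left this hη.le).trans hdec))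
        rw [if_pos hg, if_neg hg']
        have : 2 * F (x t + s t) / D ≤ 2 * F (x t) / D := by gcongr
        linarith
    rw [hx, potential, potential]
    linarith
  · obtain ⟨hx, hσ⟩ := hrun.reject t hR hρ
    rw [hx, hσ, potential, potential, Real.log_mul hγ0.ne' hσt.ne', add_div, div_self hlogγ.ne']
    linarith

theorem IsARCRun.iterations_le (hp : AdmissibleParams L KH η ν ζ εg εH ε) (hγ : 1 < γ)
    (hσmin : 0 < σmin) (hσ₀ : σmin ≤ σ₀) (hmax : max σ₀ (6 * γ * L) ≤ σmax)
    (hK : KH ≤ Kbar) (hD : 0 < D)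
    (hD1 : D ≤ η * (ν ^ 3 / (6 * σmax ^ 2) * εH ^ 3))
    (hD2 : D ≤ η * (σmin / 6 * min 1 ((1 - 2 * ζ) / (L + σmax + ζ + ζ * Kbar)) ^ (3 / 2 : ℝ)
      * εg ^ (3 / 2 : ℝ))) {Δ : ℝ} (hΔ : ∀ y, F x₀ - F y ≤ Δ)
    (hrun : IsARCRun εg εH η γ σmin KH ν ζ F x₀ σ₀ H x s σ) {T : ℕ}
    (hacc : ∀ t < T, AccurateStep L KH ν ζ εg εH ε F (H t) (σ t) (x t) (s t))
    (hR : ∀ t < T, Running εg εH F H x t) :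
    (T : ℝ) ≤ 4 * Δ / D + 2 + (Real.log σmax - Real.log σ₀) / Real.log γ := by
  have hσ := hrun.sigma_mem hp hγ hσmin hσ₀ hmax hacc hR
  have hpot : ∀ t ≤ T, potential γ εg D F (x t) (σ t) ≤ potential γ εg D F x₀ σ₀ - t := by
    intro t
    induction t with
    | zero => intro _; rw [hrun.init_x, hrun.init_σ]; simp
    | succ t ih =>
      intro ht
      have h1 := ih (by omega)
      have h2 := hrun.potential_succ_le hp hγ hσmin hK hD hD1 hD2 (hacc t (by omega))
        (hR t (by omega)) (hσ t (by omega)).1 (hσ t (by omega)).2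
      push_cast
      linarith
  have h1 := hpot T le_rfl
  have hlogγ : 0 < Real.log γ := Real.log_pos hγ
  have h2 : Real.log (σ T) / Real.log γ ≤ Real.log σmax / Real.log γ := by
    have := hσ T le_rfl
    have : 0 < σ T := by linarith
    gcongr
    exact (hσ T le_rfl).2
  have h3 : 4 * F x₀ / D - 4 * F (x T) / D ≤ 4 * Δ / D := by
    rw [← sub_div]
    gcongr
    linarith [hΔ (x T)]
  have h4 : (if εg < ‖gradient F x₀‖ then (1 : ℝ) else 0) ≤ 1 := by split_ifs <;> norm_num
  have h5 : (0 : ℝ) ≤ if εg < ‖gradient F (x T)‖ then 1 else 0 := by split_ifs <;> norm_num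
  rw [potential, potential] at h1
  rw [sub_div]
  have e1 : 2 * (2 * F x₀ / D) = 4 * F x₀ / D := by ring
  have e2 : 2 * (2 * F (x T) / D) = 4 * F (x T) / D := by ring
  linarith

end Run

/-! ### From accuracy of the Hessians to success of the algorithm -/

theorem min_mul_max_inv {a b : ℝ} (ha : 0 < a) (hb : 0 < b) : min a b * max a⁻¹ b⁻¹ = 1 := by
  rcases le_total a b with h | h
  · rw [min_eq_left h, max_eq_left (inv_anti₀ ha h), mul_inv_cancel₀ ha.ne']
  · rw [min_eq_right h, max_eq_right (inv_anti₀ hb h), mul_inv_cancel₀ hb.ne']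

theorem min_rpow_mul_max_rpow {εg εH : ℝ} (hg : 0 < εg) (hH : 0 < εH) :
    min (εg ^ (3 / 2 : ℝ)) (εH ^ (3 : ℝ)) * max (εg ^ (-(3 / 2) : ℝ)) (εH ^ (-3 : ℝ)) = 1 := by
  rw [Real.rpow_neg hg.le, Real.rpow_neg hH.le]
  exact min_mul_max_inv (Real.rpow_pos_of_pos hg _) (Real.rpow_pos_of_pos hH _)

theorem one_le_max_rpow {εg : ℝ} (hg : 0 < εg) (hg1 : εg < 1) (b : ℝ) :
    1 ≤ max (εg ^ (-(3 / 2) : ℝ)) b :=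
  le_max_of_le_left (Real.one_le_rpow_of_pos_of_le_one_of_nonpos hg hg1.le (by norm_num))

/-- The upper bound on the regularization parameter. -/
noncomputable def sigmaBound (L γ σ₀ : ℝ) : ℝ := max σ₀ (6 * γ * L)

/-- The constant in the decrease of the objective over (at most) two successful iterations. -/
noncomputable def decreaseConst (L η γ ν ζ σ₀ σmin Kbar : ℝ) : ℝ :=
  η * min (ν ^ 3 / (6 * sigmaBound L γ σ₀ ^ 2))
    (σmin / 6 * min 1 ((1 - 2 * ζ) / (L + sigmaBound L γ σ₀ + ζ + ζ * Kbar)) ^ (3 / 2 : ℝ))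

/-- The constant in the bound on the number of iterations. -/
noncomputable def iterationConst (L η γ ν ζ σ₀ σmin Kbar Δ : ℝ) : ℝ :=
  4 * Δ / decreaseConst L η γ ν ζ σ₀ σmin Kbar + 2
    + (Real.log (sigmaBound L γ σ₀) - Real.log σ₀) / Real.log γ

section Constants

variable {L η γ ν ζ σ₀ σmin Kbar KH εg εH ε Δ : ℝ}

theorem sigmaBound_pos (hσ₀ : 0 < σ₀) : 0 < sigmaBound L γ σ₀ := lt_max_of_lt_left hσ₀

theorem decreaseConst_pos (hp : AdmissibleParams L KH η ν ζ εg εH ε) (hK : KH ≤ Kbar)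
    (hσmin : 0 < σmin) (hσ₀ : 0 < σ₀) : 0 < decreaseConst L η γ ν ζ σ₀ σmin Kbar := by
  have h1 := hp.η_pos
  have h2 := hp.ν_pos
  have h3 := hp.ζ_pos
  have h4 : 0 < 1 - 2 * ζ := by linarith [hp.ζ_lt]
  have h5 := hp.L_pos
  have h6 : 0 < Kbar := hp.KH_pos.trans_le hK
  have h7 : 0 < sigmaBound L γ σ₀ := sigmaBound_pos hσ₀
  have h8 : 0 < min 1 ((1 - 2 * ζ) / (L + sigmaBound L γ σ₀ + ζ + ζ * Kbar)) :=
    lt_min one_pos (by positivity)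
  have h9 := Real.rpow_pos_of_pos h8 (3 / 2)
  exact mul_pos h1 (lt_min (by positivity) (by positivity))

theorem iterationConst_nonneg (hc : 0 < decreaseConst L η γ ν ζ σ₀ σmin Kbar) (hγ : 1 < γ)
    (hσ₀ : 0 < σ₀) (hΔ : 0 ≤ Δ) : 0 ≤ iterationConst L η γ ν ζ σ₀ σmin Kbar Δ := by
  have h1 : 0 < Real.log γ := Real.log_pos hγ
  have h2 : Real.log σ₀ ≤ Real.log (sigmaBound L γ σ₀) := Real.log_le_log hσ₀ (le_max_left _ _)
  have h3 : 0 ≤ (Real.log (sigmaBound L γ σ₀) - Real.log σ₀) / Real.log γ :=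
    div_nonneg (by linarith) h1.le
  have h4 : 0 ≤ 4 * Δ / decreaseConst L η γ ν ζ σ₀ σmin Kbar := by positivity
  rw [iterationConst]
  linarith

/-- A run whose first `T` iterations are accurate and do not stop has `T = O(max …)`. -/
theorem IsARCRun.iterations_le_const (hp : AdmissibleParams L KH η ν ζ εg εH ε) (hγ : 1 < γ)
    (hσmin : 0 < σmin) (hσ₀ : σmin ≤ σ₀) (hK : KH ≤ Kbar) {F : Vec d → ℝ} {x₀ : Vec d}
    (hΔ : ∀ y, F x₀ - F y ≤ Δ) {H : ℕ → Op d} {x s : ℕ → Vec d} {σ : ℕ → ℝ}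
    (hrun : IsARCRun εg εH η γ σmin KH ν ζ F x₀ σ₀ H x s σ) {T : ℕ}
    (hacc : ∀ t < T, AccurateStep L KH ν ζ εg εH ε F (H t) (σ t) (x t) (s t))
    (hR : ∀ t < T, Running εg εH F H x t) :
    (T : ℝ) ≤ iterationConst L η γ ν ζ σ₀ σmin Kbar Δ
      * max (εg ^ (-(3 / 2) : ℝ)) (εH ^ (-3 : ℝ)) := by
  have hσ₀' : 0 < σ₀ := hσmin.trans_le hσ₀
  have hc : 0 < decreaseConst L η γ ν ζ σ₀ σmin Kbar := decreaseConst_pos hp hK hσmin hσ₀'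
  set m := min (εg ^ (3 / 2 : ℝ)) (εH ^ (3 : ℝ)) with hm
  set M := max (εg ^ (-(3 / 2) : ℝ)) (εH ^ (-3 : ℝ)) with hM
  have hmM : m * M = 1 := min_rpow_mul_max_rpow hp.εg_pos hp.εH_pos
  have hM1 : 1 ≤ M := one_le_max_rpow hp.εg_pos hp.εg_lt _
  have hm0 : 0 < m :=
    lt_min (Real.rpow_pos_of_pos hp.εg_pos _) (Real.rpow_pos_of_pos hp.εH_pos _)
  have hη := hp.η_pos
  have hD1 : decreaseConst L η γ ν ζ σ₀ σmin Kbar * m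
      ≤ η * (ν ^ 3 / (6 * sigmaBound L γ σ₀ ^ 2) * εH ^ 3) := by
    rw [decreaseConst, mul_assoc]
    have h1 : m ≤ εH ^ 3 := (min_le_right _ _).trans (le_of_eq (by norm_cast))
    have hν := hp.ν_pos
    gcongr
    exact min_le_left _ _
  have hD2 : decreaseConst L η γ ν ζ σ₀ σmin Kbar * m
      ≤ η * (σmin / 6 * min 1 ((1 - 2 * ζ) / (L + sigmaBound L γ σ₀ + ζ + ζ * Kbar)) ^ (3 / 2 : ℝ)
        * εg ^ (3 / 2 : ℝ)) := by
    have h0 := pos_of_mul_pos_right hc hη.le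
    rw [decreaseConst, mul_assoc]
    refine mul_le_mul_of_nonneg_left ?_ hη.le
    refine mul_le_mul (min_le_right _ _) (min_le_left _ _) hm0.le
      (h0.le.trans (min_le_right _ _))
  have h1 := hrun.iterations_le hp hγ hσmin hσ₀ le_rfl hK (mul_pos hc hm0) hD1 hD2 hΔ hacc hR
  refine h1.trans ?_
  have hlog : 0 ≤ (Real.log (sigmaBound L γ σ₀) - Real.log σ₀) / Real.log γ :=
    div_nonneg (sub_nonneg.mpr (Real.log_le_log hσ₀' (le_max_left _ _))) (Real.log_pos hγ).le
  have h2 : 4 * Δ / (decreaseConst L η γ ν ζ σ₀ σmin Kbar * m)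
      = 4 * Δ / decreaseConst L η γ ν ζ σ₀ σmin Kbar * M := by
    rw [← div_div, div_eq_mul_inv _ m, inv_eq_of_mul_eq_one_right hmM]
  have h3 : (2 : ℝ) ≤ 2 * M := by linarith
  have h4 := le_mul_of_one_le_right hlog hM1
  rw [h2, iterationConst, add_mul, add_mul]
  exact add_le_add (add_le_add le_rfl h3) h4

end Constants

/-! ### Union bound over iterations and conditioning on the past -/

section Probability

variable {Ω : Type*} {mΩ : MeasurableSpace Ω} {μ : Measure Ω} [IsProbabilityMeasure μ]

/-- Outside the union of the first `T₀` bad events a run cannot avoid stopping before `T₀`, and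
accuracy at the stopping time transfers the eigenvalue test from `H` to the true Hessian. -/
theorem success_probability_ge {n N : ℕ} (hd : 0 < d) {ℱ : Filtration ℕ mΩ}
    {L η γ ν ζ σ₀ σmin Kbar KH εg εH ε Δ δ δ₀ C : ℝ}
    (hp : AdmissibleParams L KH η ν ζ εg εH ε) (hγ : 1 < γ)
    (hσmin : 0 < σmin) (hσ₀ : σmin ≤ σ₀) (hK : KH ≤ Kbar) (hδ : 0 < δ)
    (hC1 : 1 ≤ C) (hC : iterationConst L η γ ν ζ σ₀ σmin Kbar Δ + 1 ≤ C)
    (hδ₀ : δ₀ = δ * min (εg ^ (3 / 2 : ℝ)) (εH ^ (3 : ℝ)) / C)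
    {F : Vec d → ℝ} {x₀ : Vec d} (hΔ : ∀ y, F x₀ - F y ≤ Δ) (hF : TwiceDifferentiable F)
    (hFK : ∀ y, ‖hessian F y‖ ≤ KH) {S : ℕ → Ω → Fin N → Fin n} {H : ℕ → Ω → Op d}
    {x s : ℕ → Ω → Vec d} {σ : ℕ → Ω → ℝ} (hsymm : ∀ t ω, IsSymm (H t ω))
    (hnorm : ∀ t ω, ‖H t ω‖ ≤ KH)
    (hbad : ∀ t, μ.real {ω | ε < ‖H t ω - hessian F (x t ω)‖} ≤ δ₀)
    (hARC : IsRandomARC μ ℱ εg εH η γ σmin KH ν ζ L F x₀ σ₀ S H x s σ) :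
    1 - δ ≤ μ.real (successEvent εg εH ε
      (C * max (εg ^ (-(3 / 2) : ℝ)) (εH ^ (-3 : ℝ))) F H x) := by
  set m := min (εg ^ (3 / 2 : ℝ)) (εH ^ (3 : ℝ)) with hm
  set M := max (εg ^ (-(3 / 2) : ℝ)) (εH ^ (-3 : ℝ)) with hM
  set C' := iterationConst L η γ ν ζ σ₀ σmin Kbar Δ with hC'
  have hmM : m * M = 1 := min_rpow_mul_max_rpow hp.εg_pos hp.εH_pos
  have hM1 : 1 ≤ M := one_le_max_rpow hp.εg_pos hp.εg_lt _
  have hm0 : 0 < m :=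
    lt_min (Real.rpow_pos_of_pos hp.εg_pos _) (Real.rpow_pos_of_pos hp.εH_pos _)
  have hΔ0 : 0 ≤ Δ := by simpa using hΔ x₀
  have hσ₀' : 0 < σ₀ := hσmin.trans_le hσ₀
  have hC'0 : 0 ≤ C' :=
    iterationConst_nonneg (decreaseConst_pos hp hK hσmin hσ₀') hγ hσ₀' hΔ0
  -- Strictly above the deterministic bound `C' * M`, yet at most `(C' + 1) * M` because `1 ≤ M`;
  -- this is the source of the `+ 1` required of `C`.
  set T₀ := ⌊C' * M⌋₊ + 1 with hT₀
  have hT₀lt : C' * M < T₀ := by rw [hT₀]; push_cast; exact Nat.lt_floor_add_one _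
  have hT₀le : (T₀ : ℝ) ≤ C * M := by
    have h1 : (⌊C' * M⌋₊ : ℝ) ≤ C' * M := Nat.floor_le (by positivity)
    have h2 : (C' + 1) * M ≤ C * M := by gcongr
    rw [hT₀]
    push_cast
    linarith
  set U : Set Ω := ⋃ t ∈ Finset.range T₀, {ω | ε < ‖H t ω - hessian F (x t ω)‖} with hU
  have hUδ : μ.real U ≤ δ := by
    calc μ.real U ≤ ∑ t ∈ Finset.range T₀, μ.real {ω | ε < ‖H t ω - hessian F (x t ω)‖} :=
          measureReal_biUnion_finset_le _ _
      _ ≤ ∑ t ∈ Finset.range T₀, δ₀ := Finset.sum_le_sum fun t _ => hbad t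
      _ = T₀ * δ₀ := by simp
      _ ≤ (C * M) * δ₀ := by
          have : 0 ≤ δ₀ := by rw [hδ₀]; positivity
          gcongr
      _ = δ * (m * M) := by rw [hδ₀]; field_simp
      _ = δ := by rw [hmM, mul_one]
  have hcover : ∀ᵐ ω ∂μ, ω ∈ successEvent εg εH ε (C * M) F H x ∪ U := by
    filter_upwards [hARC.isRun, hARC.lipschitz] with ω hrun hlip
    by_cases hω : ω ∈ U
    · exact Or.inr hω
    refine Or.inl ?_
    have hclose : ∀ t < T₀, ‖H t ω - hessian F (x t ω)‖ ≤ ε := by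
      intro t ht
      by_contra! hcon
      exact hω (Set.mem_biUnion (by simpa using ht) hcon)
    have hex : ∃ t, t < T₀ ∧ Stops εg εH F (H t ω) (x t ω) := by
      by_contra! hcon
      have hR : ∀ t < T₀, Running εg εH F (fun t => H t ω) (fun t => x t ω) t :=
        fun t ht u hu => hcon u (hu.trans_lt ht)
      have := hrun.iterations_le_const hp hγ hσmin hσ₀ hK hΔ (T := T₀) (fun t ht =>
        { twice := hF
          hess_le := hFK
          symm := hsymm t ω
          norm_le := hnorm t ω
          lip := hlip t (hR t ht)
          close := hclose t ht
          not_stops := hcon t ht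
          approx := hrun.subproblem t (hR t ht) }) hR
      linarith
    classical
    have hhalt := (Nat.find_spec hex)
    have hmin := fun u => Nat.find_min (H := hex) (m := u)
    set T := Nat.find hex
    refine ⟨T, ?_, fun u hu hcon => hmin u hu ⟨hu.trans hhalt.1, hcon⟩, hhalt.2, hhalt.2.1, ?_⟩
    · have : (T : ℝ) ≤ T₀ := by exact_mod_cast hhalt.1.le
      linarith
    · have h1 := lamMin_sub_le hd (hclose T hhalt.1)
      linarith [hhalt.2.2]
  have h1 : (1 : ℝ) ≤ μ.real (successEvent εg εH ε (C * M) F H x ∪ U) := by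
    have : μ (successEvent εg εH ε (C * M) F H x ∪ U) = 1 := by
      rw [← measure_univ (μ := μ)]
      refine measure_congr ?_
      filter_upwards [hcover] with ω hω
      exact propext ⟨fun _ => trivial, fun _ => hω⟩
    rw [measureReal_def, this]
    simp
  linarith [measureReal_union_le (μ := μ) (successEvent εg εH ε (C * M) F H x) U]

/-- A conditional bound on the probability of drawing a bad sample, given the current iterate,
gives an unconditional one. -/
theorem measureReal_bad_sample_le {J : Type*} [Fintype J] [MeasurableSpace J]
    [MeasurableSingletonClass J] {m : MeasurableSpace Ω} (hm : m ≤ mΩ) {S : Ω → J}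
    (hS : Measurable[mΩ] S) {x : Ω → Vec d} (hx : Measurable[m] x) {Bad : J → Set (Vec d)}
    (hBad : ∀ j, MeasurableSet (Bad j)) {δ : ℝ}
    (h : ∀ᵐ ω ∂μ, ∑ j, (Bad j).indicator
      (fun _ => (μ[(S ⁻¹' {j}).indicator (fun _ => (1 : ℝ)) | m]) ω) (x ω) ≤ δ) :
    μ.real {ω | x ω ∈ Bad (S ω)} ≤ δ := by
  have hSj : ∀ j, MeasurableSet[mΩ] (S ⁻¹' {j}) := fun j => hS (measurableSet_singleton j)
  have hxj : ∀ j, MeasurableSet[m] (x ⁻¹' Bad j) := fun j => hx (hBad j)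
  -- The finitely many sample values are separated so that each event `x ∈ Bad j` belongs to `m` and
  -- conditional expectations integrate over it.
  have hsub : {ω | x ω ∈ Bad (S ω)} ⊆ ⋃ j ∈ (Finset.univ : Finset J),
      (S ⁻¹' {j} ∩ x ⁻¹' Bad j) := fun ω hω =>
    Set.mem_biUnion (Finset.mem_univ (S ω)) ⟨rfl, hω⟩
  have hint : ∀ j, Integrable ((x ⁻¹' Bad j).indicator
      (μ[(S ⁻¹' {j}).indicator (fun _ => (1 : ℝ)) | m])) μ := fun j =>
    integrable_condExp.indicator (hm _ (hxj j))
  calc μ.real {ω | x ω ∈ Bad (S ω)} ≤ ∑ j, μ.real (S ⁻¹' {j} ∩ x ⁻¹' Bad j) :=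
        (measureReal_mono hsub).trans (measureReal_biUnion_finset_le _ _)
    _ = ∑ j, ∫ ω, (x ⁻¹' Bad j).indicator
          (μ[(S ⁻¹' {j}).indicator (fun _ => (1 : ℝ)) | m]) ω ∂μ := by
        refine Finset.sum_congr rfl fun j _ => ?_
        rw [integral_indicator (hm _ (hxj j)), setIntegral_condExp hm
          ((integrable_const (1 : ℝ)).indicator (hSj j)) (hxj j),
          setIntegral_indicator (hSj j), setIntegral_const, smul_eq_mul, mul_one, Set.inter_comm]
    _ = ∫ ω, ∑ j, (x ⁻¹' Bad j).indicator
          (μ[(S ⁻¹' {j}).indicator (fun _ => (1 : ℝ)) | m]) ω ∂μ :=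
        (integral_finsetSum _ fun j _ => hint j).symm
    _ ≤ ∫ _, δ ∂μ := by
        refine integral_mono_ae (integrable_finsetSum _ fun j _ => hint j)
          (integrable_const δ) ?_
        filter_upwards [h] with ω hω
        exact hω
    _ = δ := by simp

end Probability

variable {n N : ℕ}

/-! ### Finite sums and sub-sampled Hessians -/

theorem hasGradientAt_finiteSum {f : Fin n → Vec d → ℝ} (hf : ∀ i, TwiceDifferentiable (f i))
    (x : Vec d) :
    HasGradientAt (finiteSum f) ((1 / (n : ℝ)) • ∑ i, gradient (f i) x) x := by
  apply hasGradientAt_of_hasFDerivAt_innerSL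
  have h := (HasFDerivAt.fun_sum (u := Finset.univ) fun i _ =>
    HasGradientAt.hasFDerivAt_innerSL ((hf i).hasGradientAt x)).const_mul (1 / (n : ℝ))
  refine h.congr_fderiv ?_
  simp

theorem gradient_finiteSum {f : Fin n → Vec d → ℝ} (hf : ∀ i, TwiceDifferentiable (f i)) :
    gradient (finiteSum f) = fun x => (1 / (n : ℝ)) • ∑ i, gradient (f i) x :=
  funext fun x => (hasGradientAt_finiteSum hf x).gradient

theorem hasFDerivAt_gradient_finiteSum {f : Fin n → Vec d → ℝ}
    (hf : ∀ i, TwiceDifferentiable (f i)) (x : Vec d) :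
    HasFDerivAt (gradient (finiteSum f)) ((1 / (n : ℝ)) • ∑ i, hessian (f i) x) x := by
  rw [gradient_finiteSum hf]
  exact (HasFDerivAt.fun_sum (u := Finset.univ) fun i _ =>
    (hf i).hasFDerivAt_gradient x).const_smul (1 / (n : ℝ))

theorem twiceDifferentiable_finiteSum {f : Fin n → Vec d → ℝ}
    (hf : ∀ i, TwiceDifferentiable (f i)) : TwiceDifferentiable (finiteSum f) :=
  ⟨fun x => (hasGradientAt_finiteSum hf x).differentiableAt,
    fun x => (hasFDerivAt_gradient_finiteSum hf x).differentiableAt⟩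

theorem hessian_finiteSum {f : Fin n → Vec d → ℝ} (hf : ∀ i, TwiceDifferentiable (f i))
    (x : Vec d) : hessian (finiteSum f) x = ∑ i, (1 / (n : ℝ)) • hessian (f i) x := by
  rw [← Finset.smul_sum]
  exact (hasFDerivAt_gradient_finiteSum hf x).fderiv

theorem norm_hessian_finiteSum_le {f : Fin n → Vec d → ℝ} (hf : ∀ i, TwiceDifferentiable (f i))
    {K : Fin n → ℝ} (hK : ∀ i y, ‖hessian (f i) y‖ ≤ K i) (x : Vec d) :
    ‖hessian (finiteSum f) x‖ ≤ (1 / (n : ℝ)) * ∑ i, K i := by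
  rw [hessian_finiteSum hf, Finset.mul_sum]
  refine norm_sum_le_of_le _ fun i _ => ?_
  rw [norm_smul, Real.norm_of_nonneg (by positivity)]
  exact mul_le_mul_of_nonneg_left (hK i x) (by positivity)

theorem op_smul_zero (c : ℝ) : c • (0 : Op d) = 0 := by
  ext1 v; simp

theorem subsampledHessian_eq (f : Fin n → Vec d → ℝ) (p : Fin n → ℝ) (S : Fin N → Fin n)
    (x : Vec d) : subsampledHessian f p S x
      = (1 / (N : ℝ)) • ∑ k, (1 / ((n : ℝ) * p (S k))) • hessian (f (S k)) x := by
  rw [subsampledHessian, Finset.smul_sum, Finset.smul_sum]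
  refine Finset.sum_congr rfl fun k _ => ?_
  rw [smul_smul, smul_smul]
  congr 1
  simp only [one_div, mul_inv]
  ring

theorem isSymm_subsampledHessian {f : Fin n → Vec d → ℝ} (hf : ∀ i, TwiceDifferentiable (f i))
    (p : Fin n → ℝ) (S : Fin N → Fin n) (x : Vec d) : IsSymm (subsampledHessian f p S x) :=
  (isSymm_sum _ fun k _ => (isSymm_hessian (hf (S k)) x).smul _).smul _

theorem norm_average_le {X : Fin n → Op d} {K : ℝ} (hK : 0 ≤ K) (hX : ∀ i, ‖X i‖ ≤ K)
    (j : Fin N → Fin n) : ‖(1 / (N : ℝ)) • ∑ k, X (j k)‖ ≤ K := by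
  rw [norm_smul, Real.norm_of_nonneg (by positivity)]
  rcases Nat.eq_zero_or_pos N with rfl | hN
  · simpa using hK
  · have hN' : (0 : ℝ) < N := by exact_mod_cast hN
    have h : ‖∑ k, X (j k)‖ ≤ N * K := by
      refine (norm_sum_le_of_le _ fun k _ => hX (j k)).trans (le_of_eq ?_)
      simp
    calc _ ≤ 1 / (N : ℝ) * (N * K) := by gcongr
      _ = K := by field_simp

/-! ### Measurability of the bad sets -/

/-- A derivative is Borel measurable even where it is not continuous, so the bad sets need no
smoothness beyond this. -/
theorem measurable_hessian (F : Vec d → ℝ) : Measurable (hessian F) :=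
  measurable_fderiv ℝ (gradient F)

theorem measurable_subsampledHessian (f : Fin n → Vec d → ℝ) {p : Vec d → Fin n → ℝ}
    (hp : ∀ i, Measurable fun x => p x i) (S : Fin N → Fin n) :
    Measurable fun x => subsampledHessian f (p x) S x := by
  have h : Measurable fun x => ∑ k, (1 / p x (S k)) • hessian (f (S k)) x :=
    Finset.measurable_sum _ fun k _ =>
      ((hp (S k)).const_div 1).smul (measurable_hessian (f (S k)))
  exact h.const_smul (1 / ((n : ℝ) * (N : ℝ)))

theorem measurableSet_bad {G : Vec d → Op d} (hG : Measurable G) (F : Vec d → ℝ) (ε : ℝ) :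
    MeasurableSet {x | ε < ‖G x - hessian F x‖} :=
  measurableSet_lt measurable_const (hG.sub (measurable_hessian F)).norm

/-! ### Ridge functions -/

section Ridge

variable {φ : Fin n → ℝ → ℝ} {a : Fin n → Vec d}

theorem hasGradientAt_ridge (hφ : ∀ i, Differentiable ℝ (φ i) ∧ Differentiable ℝ (deriv (φ i)))
    (i : Fin n) (x : Vec d) :
    HasGradientAt (ridge φ a i) (deriv (φ i) (inner ℝ (a i) x) • a i) x := by
  apply hasGradientAt_of_hasFDerivAt_innerSL
  have h := ((hφ i).1 (inner ℝ (a i) x)).hasDerivAt.comp_hasFDerivAt x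
    (innerSL ℝ (a i)).hasFDerivAt
  refine h.congr_fderiv ?_
  simp

theorem hasFDerivAt_gradient_ridge
    (hφ : ∀ i, Differentiable ℝ (φ i) ∧ Differentiable ℝ (deriv (φ i)))
    (i : Fin n) (x : Vec d) :
    HasFDerivAt (gradient (ridge φ a i))
      (deriv (deriv (φ i)) (inner ℝ (a i) x) • (innerSL ℝ (a i)).smulRight (a i)) x := by
  have hg : gradient (ridge φ a i) = fun x => deriv (φ i) (inner ℝ (a i) x) • a i :=
    funext fun x => (hasGradientAt_ridge hφ i x).gradient
  rw [hg]
  have h := (((hφ i).2 (inner ℝ (a i) x)).hasDerivAt.comp_hasFDerivAt x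
    (innerSL ℝ (a i)).hasFDerivAt).smul_const (a i)
  refine h.congr_fderiv ?_
  ext v
  simp [mul_assoc]

theorem twiceDifferentiable_ridge
    (hφ : ∀ i, Differentiable ℝ (φ i) ∧ Differentiable ℝ (deriv (φ i))) (i : Fin n) :
    TwiceDifferentiable (ridge φ a i) :=
  ⟨fun x => (hasGradientAt_ridge hφ i x).differentiableAt,
    fun x => (hasFDerivAt_gradient_ridge hφ i x).differentiableAt⟩

theorem norm_hessian_ridge (hφ : ∀ i, Differentiable ℝ (φ i) ∧ Differentiable ℝ (deriv (φ i)))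
    (i : Fin n) (x : Vec d) : ‖hessian (ridge φ a i) x‖ = ridgeWeight φ a x i := by
  rw [hessian, (hasFDerivAt_gradient_ridge hφ i x).fderiv, norm_smul,
    ContinuousLinearMap.norm_smulRight_apply, innerSL_apply_norm, ridgeWeight, Real.norm_eq_abs, sq]

theorem ridgeWeight_nonneg (φ : Fin n → ℝ → ℝ) (a : Fin n → Vec d) (x : Vec d) (i : Fin n) :
    0 ≤ ridgeWeight φ a x i := by
  rw [ridgeWeight]; positivity

theorem measurable_ridgeProb (φ : Fin n → ℝ → ℝ) (a : Fin n → Vec d) (i : Fin n) :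
    Measurable fun x => ridgeProb φ a x i := by
  have hw : ∀ i, Measurable fun x => ridgeWeight φ a x i := fun i =>
    (((measurable_deriv (deriv (φ i))).comp (innerSL ℝ (a i)).continuous.measurable).abs).mul_const _
  exact (hw i).div (Finset.measurable_sum _ fun j _ => hw j)

theorem ridgeProb_nonneg (x : Vec d) (i : Fin n) : 0 ≤ ridgeProb φ a x i :=
  div_nonneg (ridgeWeight_nonneg _ _ _ _) (Finset.sum_nonneg fun _ _ => ridgeWeight_nonneg _ _ _ _)

/-- The Hessian of a ridge function has norm equal to its weight, so division by `n p_i` leaves the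
average weight whenever `p_i ≠ 0`, and zero otherwise. -/
theorem norm_reweighted_hessian_ridge_le
    (hφ : ∀ i, Differentiable ℝ (φ i) ∧ Differentiable ℝ (deriv (φ i))) {K : Fin n → ℝ}
    (hK : ∀ i y, ‖hessian (ridge φ a i) y‖ ≤ K i) (x : Vec d) (i : Fin n) :
    ‖(1 / ((n : ℝ) * ridgeProb φ a x i)) • hessian (ridge φ a i) x‖
      ≤ (1 / (n : ℝ)) * ∑ i, K i := by
  have hW : ∑ j, ridgeWeight φ a x j ≤ ∑ j, K j :=
    Finset.sum_le_sum fun j _ => (norm_hessian_ridge hφ j x).symm.trans_le (hK j x)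
  have hW0 : 0 ≤ ∑ j, ridgeWeight φ a x j :=
    Finset.sum_nonneg fun _ _ => ridgeWeight_nonneg _ _ _ _
  rw [norm_smul, norm_hessian_ridge hφ, Real.norm_of_nonneg
    (one_div_nonneg.mpr (mul_nonneg (Nat.cast_nonneg _) (ridgeProb_nonneg _ _)))]
  refine le_trans ?_ (mul_le_mul_of_nonneg_left hW (by positivity))
  rcases (ridgeWeight_nonneg φ a x i).eq_or_lt with h0 | h0
  · rw [← h0, mul_zero]; positivity
  · have hWpos : 0 < ∑ j, ridgeWeight φ a x j := h0.trans_le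
      (Finset.single_le_sum (fun j _ => ridgeWeight_nonneg φ a x j) (Finset.mem_univ i))
    rw [ridgeProb]
    apply le_of_eq
    field_simp

theorem sum_ridgeProb {x : Vec d} (h : ∑ i, ridgeWeight φ a x i ≠ 0) :
    ∑ i, ridgeProb φ a x i = 1 := by
  simp only [ridgeProb]
  rw [← Finset.sum_div, div_self h]

/-- Unbiasedness. Indices of probability zero do no harm, since their Hessians vanish. -/
theorem sum_ridgeProb_smul_hessian (hn : 0 < n)
    (hφ : ∀ i, Differentiable ℝ (φ i) ∧ Differentiable ℝ (deriv (φ i))) (x : Vec d) :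
    ∑ i, ridgeProb φ a x i • ((1 / ((n : ℝ) * ridgeProb φ a x i)) • hessian (ridge φ a i) x)
      = hessian (finiteSum (ridge φ a)) x := by
  rw [hessian_finiteSum (twiceDifferentiable_ridge hφ)]
  refine Finset.sum_congr rfl fun i _ => ?_
  have hn' : (n : ℝ) ≠ 0 := by exact_mod_cast hn.ne'
  rcases (ridgeWeight_nonneg φ a x i).eq_or_lt with h0 | h0
  · have : hessian (ridge φ a i) x = 0 := by
      rw [← norm_eq_zero, norm_hessian_ridge hφ, ← h0]
    simp only [this, op_smul_zero]
  · have hWpos : 0 < ∑ j, ridgeWeight φ a x j := h0.trans_le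
      (Finset.single_le_sum (fun j _ => ridgeWeight_nonneg φ a x j) (Finset.mem_univ i))
    have hp : ridgeProb φ a x i ≠ 0 := (div_pos h0 hWpos).ne'
    rw [smul_smul]
    congr 1
    field_simp

end Ridge

/-! ### Accuracy of the sub-sampled Hessians -/

section Accuracy

variable {Ω : Type*} {mΩ : MeasurableSpace Ω} {μ : Measure Ω} [IsProbabilityMeasure μ]
  {ℱ : Filtration ℕ mΩ} {S : ℕ → Ω → Fin N → Fin n} {x : ℕ → Ω → Vec d} {ε δ₀ : ℝ}

theorem uniform_sampling_inaccurate_le (hd : 0 < d) (hn : 0 < n) {f : Fin n → Vec d → ℝ}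
    (hf : ∀ i, TwiceDifferentiable (f i)) {K : ℝ} (hK0 : 0 ≤ K)
    (hK : ∀ i y, ‖hessian (f i) y‖ ≤ K) (hε : 0 < ε) (hδ₀ : 0 < δ₀) (hδ₀1 : δ₀ < 1)
    (hN : 4 * K ^ 2 / ε ^ 2 * Real.log (2 * d / δ₀) ≤ N)
    (hS : UniformWithReplacement μ ℱ S ∨ UniformWithoutReplacement μ ℱ S) (t : ℕ)
    (hSm : Measurable (S t)) (hx : Measurable[ℱ t] (x t)) :
    μ.real {ω | ε < ‖subsampledHessian f (fun _ => 1 / (n : ℝ)) (S t ω) (x t ω)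
      - hessian (finiteSum f) (x t ω)‖} ≤ δ₀ := by
  have hn' : (n : ℝ) ≠ 0 := by exact_mod_cast hn.ne'
  have hsub : ∀ (j : Fin N → Fin n) (y : Vec d),
      subsampledHessian f (fun _ => 1 / (n : ℝ)) j y
        = (1 / (N : ℝ)) • ∑ k, hessian (f (j k)) y := by
    intro j y
    rw [subsampledHessian_eq, mul_one_div_cancel hn']
    simp
  refine measureReal_bad_sample_le (ℱ.le t) hSm hx
    (Bad := fun j => {y | ε < ‖subsampledHessian f (fun _ => 1 / (n : ℝ)) j y
      - hessian (finiteSum f) y‖})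
    (fun j => measurableSet_bad (measurable_subsampledHessian f (fun _ => measurable_const) j) _ _)
    ?_
  classical
  rcases hS with hS | hS
  · filter_upwards [ae_all_iff.mpr (hS t)] with ω hω
    have h := iid_deviation_le (N := N) hd (p := fun _ : Fin n => 1 / (n : ℝ))
      (fun _ => by positivity) (by simp [hn']) (fun i => isSymm_hessian (hf i) (x t ω)) hK0
      (fun i => hK i _) hε hδ₀ hδ₀1 hN
    rw [← hessian_finiteSum hf] at h
    refine le_trans (le_of_eq (Finset.sum_congr rfl fun j _ => ?_)) h
    rw [Set.indicator_apply, hω j]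
    simp only [hsub, Set.mem_ofPred_eq, mul_ite, mul_one, mul_zero, Finset.prod_const,
      Finset.card_univ, Fintype.card_fin]
  · filter_upwards [ae_all_iff.mpr (hS t)] with ω hω
    have h := without_replacement_deviation_le (N := N) hd hn
      (fun i => isSymm_hessian (hf i) (x t ω)) hK0
      (fun i => hK i _) hε hδ₀ hδ₀1 hN
    rw [← hessian_finiteSum hf] at h
    refine le_trans (le_of_eq (Finset.sum_congr rfl fun j _ => ?_)) h
    rw [Set.indicator_apply, hω j]
    simp only [hsub, Set.mem_ofPred_eq, mul_ite, mul_one, mul_zero]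

theorem nonuniform_sampling_inaccurate_le (hd : 0 < d) (hn : 0 < n) {φ : Fin n → ℝ → ℝ}
    {a : Fin n → Vec d} (hφ : ∀ i, Differentiable ℝ (φ i) ∧ Differentiable ℝ (deriv (φ i)))
    {K : Fin n → ℝ} (hK : ∀ i y, ‖hessian (ridge φ a i) y‖ ≤ K i) (hε : 0 < ε) (hδ₀ : 0 < δ₀)
    (hδ₀1 : δ₀ < 1)
    (hN : 4 * ((1 / (n : ℝ)) * ∑ i, K i) ^ 2 / ε ^ 2 * Real.log (2 * d / δ₀) ≤ N)
    (hS : NonuniformSampling μ ℱ φ a x S) (t : ℕ)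
    (hSm : Measurable (S t)) (hx : Measurable[ℱ t] (x t)) :
    μ.real {ω | ε < ‖subsampledHessian (ridge φ a) (ridgeProb φ a (x t ω)) (S t ω) (x t ω)
      - hessian (finiteSum (ridge φ a)) (x t ω)‖} ≤ δ₀ := by
  have hK0 : 0 ≤ (1 / (n : ℝ)) * ∑ i, K i :=
    mul_nonneg (by positivity) (Finset.sum_nonneg fun i _ => (norm_nonneg _).trans (hK i 0))
  refine measureReal_bad_sample_le (ℱ.le t) hSm hx
    (Bad := fun j => {y | ε < ‖subsampledHessian (ridge φ a) (ridgeProb φ a y) j y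
      - hessian (finiteSum (ridge φ a)) y‖})
    (fun j => measurableSet_bad (measurable_subsampledHessian _ (measurable_ridgeProb φ a) j) _ _)
    ?_
  classical
  filter_upwards [ae_all_iff.mpr (hS t)] with ω hω
  -- When all weights vanish, both Hessians are zero, so an arbitrary sample has no error.
  by_cases hW : ∑ i, ridgeWeight φ a (x t ω) i = 0
  · have hzero : ∀ i, hessian (ridge φ a i) (x t ω) = 0 := by
      intro i
      rw [← norm_eq_zero, norm_hessian_ridge hφ]
      exact (Finset.sum_eq_zero_iff_of_nonneg fun i _ => ridgeWeight_nonneg _ _ _ _).mp hW i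
        (Finset.mem_univ i)
    refine (Finset.sum_eq_zero fun j _ => ?_).trans_le hδ₀.le
    rw [Set.indicator_of_notMem]
    simp only [Set.mem_ofPred_eq, hessian_finiteSum (twiceDifferentiable_ridge hφ),
      subsampledHessian, hzero, op_smul_zero, Finset.sum_const_zero, sub_zero, norm_zero]
    exact not_lt.mpr hε.le
  · have h := iid_deviation_le (N := N) hd (fun i => ridgeProb_nonneg (x t ω) i)
      (sum_ridgeProb hW)
      (fun i => (isSymm_hessian (twiceDifferentiable_ridge hφ i) (x t ω)).smul
        (1 / ((n : ℝ) * ridgeProb φ a (x t ω) i))) hK0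
      (fun i => norm_reweighted_hessian_ridge_le hφ hK _ i) hε hδ₀ hδ₀1 hN
    rw [sum_ridgeProb_smul_hessian hn hφ] at h
    refine le_trans (le_of_eq (Finset.sum_congr rfl fun j _ => ?_)) h
    rw [Set.indicator_apply, hω j hW]
    simp only [subsampledHessian_eq, Set.mem_ofPred_eq, mul_ite, mul_one, mul_zero]

end Accuracy

end SubsampledARC

/-! ### Assembly of the two sampling schemes -/

theorem mainTheorem8
    (L η γ ν ζ σ₀ σmin Kbar Δ : ℝ)
    (hL : 0 < L) (hη : 0 < η ∧ η < 1) (hγ : 1 < γ) (hν : 0 < ν ∧ ν ≤ 1)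
    (hζ : 0 < ζ ∧ ζ < 1 / 2) (hσmin : 0 < σmin) (hσ₀ : σmin ≤ σ₀) :
    ∃ C : ℝ, 1 ≤ C ∧
      ∀ (d n N : ℕ), 0 < d → 0 < n →
      ∀ (εg εH δ δ₀ ε₀ ε KH : ℝ),
        0 < εg → εg < 1 → 0 < εH → εH < 1 → 0 < δ → δ < 1 →
        0 < KH → KH ≤ Kbar →
        0 < ε₀ → ε₀ ≤ toleranceBound L KH η ν εg εH → ε = min ε₀ (ζ * εg) →
        δ₀ = δ * min (εg ^ (3 / 2 : ℝ)) (εH ^ (3 : ℝ)) / C →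
      ∀ (Ω : Type*) (mΩ : MeasurableSpace Ω) (μ : MeasureTheory.Measure Ω)
        (_ : MeasureTheory.IsProbabilityMeasure μ) (ℱ : MeasureTheory.Filtration ℕ mΩ)
        (S : ℕ → Ω → Fin N → Fin n) (x s : ℕ → Ω → Vec d) (σ : ℕ → Ω → ℝ) (x₀ : Vec d)
        (K : Fin n → ℝ),
        -- the general finite sum, with uniform sampling
        (∀ f : Fin n → Vec d → ℝ,
          (∀ i, TwiceDifferentiable (f i)) →
          (∀ i y, ‖hessian (f i) y‖ ≤ K i) →
          (⨆ i, K i) ≤ KH →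
          (∀ y, finiteSum f x₀ - finiteSum f y ≤ Δ) →
          16 * (⨆ i, K i) ^ 2 / ε ^ 2 * Real.log (2 * d / δ₀) ≤ N →
          (UniformWithReplacement μ ℱ S ∨ UniformWithoutReplacement μ ℱ S) →
          IsRandomARC μ ℱ εg εH η γ σmin KH ν ζ L (finiteSum f) x₀ σ₀ S
            (fun t ω => subsampledHessian f (fun _ => 1 / (n : ℝ)) (S t ω) (x t ω)) x s σ →
          1 - δ ≤ μ.real (successEvent εg εH ε
            (C * max (εg ^ (-(3 / 2) : ℝ)) (εH ^ (-3 : ℝ))) (finiteSum f)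
            (fun t ω => subsampledHessian f (fun _ => 1 / (n : ℝ)) (S t ω) (x t ω)) x)) ∧
        -- the finite sum of the functions `φ i (a iᵀ x)`, with non-uniform sampling
        (∀ (φ : Fin n → ℝ → ℝ) (a : Fin n → Vec d),
          (∀ i, Differentiable ℝ (φ i) ∧ Differentiable ℝ (deriv (φ i))) →
          (∀ i y, ‖hessian (ridge φ a i) y‖ ≤ K i) →
          (1 / (n : ℝ)) * ∑ i, K i ≤ KH →
          (∀ y, finiteSum (ridge φ a) x₀ - finiteSum (ridge φ a) y ≤ Δ) →
          4 * ((1 / (n : ℝ)) * ∑ i, K i) ^ 2 / ε ^ 2 * Real.log (2 * d / δ₀) ≤ N →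
          NonuniformSampling μ ℱ φ a x S →
          IsRandomARC μ ℱ εg εH η γ σmin KH ν ζ L (finiteSum (ridge φ a)) x₀ σ₀ S
            (fun t ω => subsampledHessian (ridge φ a) (ridgeProb φ a (x t ω)) (S t ω) (x t ω))
            x s σ →
          1 - δ ≤ μ.real (successEvent εg εH ε
            (C * max (εg ^ (-(3 / 2) : ℝ)) (εH ^ (-3 : ℝ))) (finiteSum (ridge φ a))
            (fun t ω => subsampledHessian (ridge φ a) (ridgeProb φ a (x t ω)) (S t ω) (x t ω))
            x)) := by
  -- The maximum with 1 keeps `1 ≤ C` even for parameters, such as `Kbar ≤ 0` or `Δ < 0`, for which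
  -- no problem instance exists.
  refine ⟨max 1 (iterationConst L η γ ν ζ σ₀ σmin Kbar Δ + 1), le_max_left _ _, ?_⟩
  intro d n N hd hn εg εH δ δ₀ ε₀ ε KH hεg hεg1 hεH hεH1 hδ hδ1 hKH hKHbar hε₀ hε₀b hε hδ₀
    Ω mΩ μ hμ ℱ S x s σ x₀ K
  set C := max 1 (iterationConst L η γ ν ζ σ₀ σmin Kbar Δ + 1) with hC
  have hC1 : 1 ≤ C := le_max_left _ _
  have hζεg : 0 < ζ * εg := mul_pos hζ.1 hεg
  have hεpos : 0 < ε := by rw [hε]; exact lt_min hε₀ hζεg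
  have hp : AdmissibleParams L KH η ν ζ εg εH ε :=
    { L_pos := hL
      KH_pos := hKH
      η_pos := hη.1
      η_lt := hη.2
      ν_pos := hν.1
      ζ_pos := hζ.1
      ζ_lt := hζ.2
      εg_pos := hεg
      εg_lt := hεg1
      εH_pos := hεH
      ε_pos := hεpos
      ε_le_bound := by rw [hε]; exact (min_le_left _ _).trans hε₀b
      ε_le := by rw [hε]; exact min_le_right _ _ }
  have hm0 : 0 < min (εg ^ (3 / 2 : ℝ)) (εH ^ (3 : ℝ)) :=
    lt_min (Real.rpow_pos_of_pos hεg _) (Real.rpow_pos_of_pos hεH _)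
  have hm1 : min (εg ^ (3 / 2 : ℝ)) (εH ^ (3 : ℝ)) ≤ 1 :=
    (min_le_left _ _).trans (Real.rpow_le_one hεg.le hεg1.le (by norm_num))
  have hδ₀pos : 0 < δ₀ := by rw [hδ₀]; positivity
  have hδ₀1 : δ₀ < 1 := by
    rw [hδ₀, div_lt_one (by linarith)]
    calc δ * min (εg ^ (3 / 2 : ℝ)) (εH ^ (3 : ℝ)) ≤ δ * 1 := by gcongr
      _ < 1 := by linarith
      _ ≤ C := hC1
  have hn' : (0 : ℝ) < n := by exact_mod_cast hn
  refine ⟨fun f hf hK hKmax hΔ hN hS hARC => ?_, fun φ a hφ hK hKhat hΔ hN hS hARC => ?_⟩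
  · have hle : ∀ i, K i ≤ ⨆ i, K i := fun i => le_ciSup (Set.finite_range K).bddAbove i
    have hKle : ∀ i y, ‖hessian (f i) y‖ ≤ ⨆ i, K i := fun i y => (hK i y).trans (hle i)
    have hKmax0 : 0 ≤ ⨆ i, K i := (norm_nonneg _).trans (hKle ⟨0, hn⟩ 0)
    have hlog : 0 ≤ Real.log (2 * d / δ₀) := by
      refine Real.log_nonneg ?_
      have hd' : (1 : ℝ) ≤ d := by exact_mod_cast hd
      rw [le_div_iff₀ hδ₀pos]
      linarith
    -- The deviation bound needs only the constant 4, so 16 is more than enough in the uniform case.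
    have hN4 : 4 * (⨆ i, K i) ^ 2 / ε ^ 2 * Real.log (2 * d / δ₀) ≤ N := by
      refine le_trans ?_ hN
      gcongr
      norm_num
    refine success_probability_ge hd hp hγ hσmin hσ₀ hKHbar hδ hC1 (le_max_right _ _) hδ₀ hΔ
      (twiceDifferentiable_finiteSum hf) (fun y => ?_) (fun t ω => isSymm_subsampledHessian hf _ _ _)
      (fun t ω => ?_) (fun t => uniform_sampling_inaccurate_le hd hn hf hKmax0 hKle hεpos hδ₀pos
        hδ₀1 hN4 hS t (hARC.measurable_sample t) (hARC.adapted t)) hARC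
    · refine (norm_hessian_finiteSum_le hf hKle y).trans (le_trans (le_of_eq ?_) hKmax)
      simp only [Finset.sum_const, Finset.card_univ, Fintype.card_fin, nsmul_eq_mul]
      field_simp
    · rw [subsampledHessian_eq, mul_one_div_cancel hn'.ne']
      simp only [div_one, one_smul]
      exact (norm_average_le hKmax0 (fun i => hKle i (x t ω)) (S t ω)).trans hKmax
  · have hKhat0 : 0 ≤ (1 / (n : ℝ)) * ∑ i, K i :=
      mul_nonneg (by positivity) (Finset.sum_nonneg fun i _ => (norm_nonneg _).trans (hK i 0))
    have hf := twiceDifferentiable_ridge (a := a) hφ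
    refine success_probability_ge hd hp hγ hσmin hσ₀ hKHbar hδ hC1 (le_max_right _ _) hδ₀ hΔ
      (twiceDifferentiable_finiteSum hf)
      (fun y => (norm_hessian_finiteSum_le hf hK y).trans hKhat)
      (fun t ω => isSymm_subsampledHessian hf _ _ _)
      (fun t ω => ?_) (fun t => nonuniform_sampling_inaccurate_le hd hn hφ hK hεpos hδ₀pos
        hδ₀1 hN hS t (hARC.measurable_sample t) (hARC.adapted t)) hARC
    rw [subsampledHessian_eq]
    exact (norm_average_le hKhat0 (fun i => norm_reweighted_hessian_ridge_le hφ hK (x t ω) i)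
      (S t ω)).trans hKhat
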